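/- Let $m,k\ge 0$ be integers, let $a_1,\dots,a_k\in\mathbb C$ be pairwise distinct, let $b_1,\dots,b_k\in\mathbb C$, and let $f(x)=\prod_{j=1}^k (x-a_j)^{b_j}$, understood as any single-valued determination of this multivalued function which is holomorphic and non-vanishing near at least one point. Let $U\subset\mathbb C$ be the set of points at which $f$ and $1/f$ are holomorphic, and put $D=U\times U$. Let $Q_m(f)$ be the space of polynomials $F\in\mathbb C[x,y]$ for which $$\frac{f(x)F(x,y)-f(y)F(y,x)}{(x-y)^{2m+1}}$$ extends to a smooth function on $D$; it is a module over the ring $R$ of symmetric polynomials in $x,y$. For $i\ge 0$ put $d_i(f)=\sum_{j=1}^k d_i(b_j)$, where $d_i(z)=\min(i,|z|)$ if $z\in\mathbb Z$ and $d_i(z)=i$ otherwise. (1) The Hilbert series of $Q_m(f)$ with respect to the filtration by total degree, $\sum_{d\ge0}t^d\dim_{\mathbb C}\bigl(Q_m(f)_{\le d}/Q_m(f)_{<d}\bigr)$, equals $$\frac{t^{2m}+t^{2m+1}+\sum_{i=1}^m t^{2(m-i)+d_i(f)}-\sum_{i=1}^m t^{2(m-i)+d_i(f)+2}}{(1-t)(1-t^2)}.$$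 (2) There are polynomials $P_i\in Q_i(f)$ ($1\le i\le m$) of total degree $d_i(f)$ with $P_i(x,x)=\prod_{j=1}^k(x-a_j)^{d_i(b_j)}$ such that the $m+2$ polynomials $(x-y)^{2(m-i)}P_i$ ($1\le i\le m$), $(x-y)^{2m}$ and $(x-y)^{2m+1}$ generate $Q_m(f)$ as an $R$-module, and the $R$-module of relations among these $m+2$ generators is generated by $m$ relations that are linearly independent over $R$. -/

import Mathlib

open scoped ContDiff

noncomputable section

/-- The set of points at which both `f` and `1/f` are smooth, i.e. `f` is holomorphic near the
point and does not vanish there. -/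
def regularSet (f : ℂ → ℂ) : Set ℂ :=
  {z | AnalyticAt ℂ f z ∧ f z ≠ 0}

/-- `f` is a single-valued determination of the multivalued function `∏ i, (z - a i) ^ b i`:
its regular set is nonempty, and at each point `z` of this set the number `f z` is one of the
values `∏ i, exp (b i * log (z - a i))`, where `L i` is any value of `log (z - a i)`.
A factor with exponent `0` is the constant `1`. Off its regular set `f` is arbitrary. -/
def IsPowerProduct {k : ℕ} (a b : Fin k → ℂ) (f : ℂ → ℂ) : Prop :=
  (regularSet f).Nonempty ∧
    ∀ z ∈ regularSet f, ∃ L : Fin k → ℂ,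
      (∀ i, b i ≠ 0 → Complex.exp (L i) = z - a i) ∧
        f z = ∏ i, Complex.exp (b i * L i)

/-- The ring of symmetric polynomials in two variables. -/
abbrev SymPoly : Subalgebra ℂ (MvPolynomial (Fin 2) ℂ) :=
  MvPolynomial.symmetricSubalgebra (Fin 2) ℂ

theorem SymPoly.eval_swap (s : SymPoly) (x y : ℂ) :
    MvPolynomial.eval ![y, x] (s : MvPolynomial (Fin 2) ℂ)
      = MvPolynomial.eval ![x, y] (s : MvPolynomial (Fin 2) ℂ) := by
  have h : MvPolynomial.rename (Equiv.swap (0 : Fin 2) 1) (s : MvPolynomial (Fin 2) ℂ) = s :=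
    s.2 _
  have e : (![x, y] : Fin 2 → ℂ) ∘ (Equiv.swap (0 : Fin 2) 1) = ![y, x] := by
    funext i
    fin_cases i <;> simp
  rw [← e, ← MvPolynomial.eval_rename, h]

/-- The twisted quasi-invariants `Q_m(f)` in two variables, as a module over the symmetric
polynomials: the polynomials `F` for which
`(f(x) F(x,y) - f(y) F(y,x)) / (x - y)^(2m+1)` is smooth, i.e. extends to a smooth function `g`,
on the domain `D × D`, with `D` the set where `f` and `1/f` are smooth. -/
def quasiInvariants (m : ℕ) (f : ℂ → ℂ) : Submodule SymPoly (MvPolynomial (Fin 2) ℂ) where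
  carrier := {F | ∃ g : ℂ × ℂ → ℂ, ContDiffOn ℂ ∞ g (regularSet f ×ˢ regularSet f) ∧
    ∀ x ∈ regularSet f, ∀ y ∈ regularSet f,
      f x * MvPolynomial.eval ![x, y] F - f y * MvPolynomial.eval ![y, x] F
        = (x - y) ^ (2 * m + 1) * g (x, y)}
  zero_mem' := ⟨0, contDiffOn_const, by simp⟩
  add_mem' := by
    rintro F G ⟨g, hg, hF⟩ ⟨h, hh, hG⟩
    refine ⟨g + h, hg.add hh, fun x hx y hy => ?_⟩
    have h1 := hF x hx y hy
    have h2 := hG x hx y hy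
    simp only [map_add, Pi.add_apply]
    linear_combination h1 + h2
  smul_mem' := by
    rintro s F ⟨g, hg, hF⟩
    refine ⟨fun p => MvPolynomial.eval ![p.1, p.2] (s : MvPolynomial (Fin 2) ℂ) * g p,
      ContDiffOn.mul ?_ hg, fun x hx y hy => ?_⟩
    · have hs : ∀ P : MvPolynomial (Fin 2) ℂ,
          ContDiff ℂ ∞ (fun p : ℂ × ℂ => MvPolynomial.eval ![p.1, p.2] P) := by
        intro P
        induction P using MvPolynomial.induction_on with
        | C c => simpa using contDiff_const
        | add P P' h h' => simpa using h.add h'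
        | mul_X P i h =>
          simp only [map_mul, MvPolynomial.eval_X]
          refine h.mul ?_
          fin_cases i
          · exact contDiff_fst
          · exact contDiff_snd
      exact (hs _).contDiffOn
    · have h1 := hF x hx y hy
      have h2 := SymPoly.eval_swap s x y
      simp only [Subalgebra.smul_def, smul_eq_mul, map_mul]
      rw [h2]
      linear_combination MvPolynomial.eval ![x, y] (s : MvPolynomial (Fin 2) ℂ) * h1

/-- The leading forms of degree `d` of the elements of `V`: the degree `d` homogeneous components
of the elements of `V` of total degree at most `d`. This is the degree `d` part
`V_{≤ d} / V_{< d}` of the graded space of `V` for the filtration by total degree; if `V` is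
spanned by homogeneous polynomials, it is the space of homogeneous elements of degree `d`. -/
def leadingForms (V : Submodule ℂ (MvPolynomial (Fin 2) ℂ)) (d : ℕ) :
    Submodule ℂ (MvPolynomial (Fin 2) ℂ) :=
  (V ⊓ MvPolynomial.restrictTotalDegree (Fin 2) ℂ d).map (MvPolynomial.homogeneousComponent d)

/-- The Hilbert series of a space of polynomials, filtered by total degree. -/
def hilbertSeries (V : Submodule ℂ (MvPolynomial (Fin 2) ℂ)) : PowerSeries ℤ :=
  PowerSeries.mk fun d => (Module.finrank ℂ (leadingForms V d) : ℤ)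

open Classical in
/-- `d_m(z)` is `min m |z|` if `z` is an integer and `m` otherwise. -/
def dExp (m : ℕ) (z : ℂ) : ℕ :=
  if z ∈ Set.range ((↑) : ℤ → ℂ) then min m ⌊‖z‖⌋₊ else m

/-- `d_m(f)` for `f = ∏ j, (x - a j) ^ b j`. -/
def dTotal {k : ℕ} (m : ℕ) (b : Fin k → ℂ) : ℕ := ∑ j, dExp m (b j)

/-- The family `(x - y)^(2(m-i)) P_i` for `1 ≤ i ≤ m`, followed by
`(x - y)^(2m)` and `(x - y)^(2m+1)`. -/
def generators (m : ℕ) (P : ℕ → MvPolynomial (Fin 2) ℂ) :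
    Fin m ⊕ Fin 2 → MvPolynomial (Fin 2) ℂ :=
  Sum.elim
    (fun i => (MvPolynomial.X 0 - MvPolynomial.X 1) ^ (2 * (m - ((i : ℕ) + 1))) * P ((i : ℕ) + 1))
    ![(MvPolynomial.X 0 - MvPolynomial.X 1) ^ (2 * m),
      (MvPolynomial.X 0 - MvPolynomial.X 1) ^ (2 * m + 1)]

/-- The module of relations with symmetric polynomial coefficients among a finite family `v`:
the families `c` with `∑ i, c i * v i = 0`. -/
def relationModule {ι : Type} [Fintype ι] (v : ι → MvPolynomial (Fin 2) ℂ) :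
    Submodule SymPoly (ι → SymPoly) :=
  LinearMap.ker (Fintype.linearCombination SymPoly v)

end

/-!
Everything rests on restriction to the diagonal, `F ↦ F(x, x)`. Write `δ = x - y`. An element of
`Q_m(f)`, `m ≥ 1`, that vanishes on the diagonal is divisible by `δ ^ 2`, with quotient in
`Q_{m-1}(f)` (`exists_eq_of_diag_eq_zero`), and `δ ^ 2 Q_{m-1}(f) ⊆ Q_m(f)`. The restrictions of the
elements of `Q_m(f)` form the ideal generated by `p_m = ∏ j, (x - a j) ^ d_m(b j)`: every
restriction is a multiple of `p_m` (`IsPowerProduct.prod_dvd_diag`), and some `P_m` in `Q_m(f)` of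
total degree `d_m(f)` restricts to `p_m` (`IsPowerProduct.exists_mem_quasiInvariants`). So there is
an exact sequence `0 → δ ^ 2 Q_{m-1}(f) → Q_m(f) → (p_m) → 0`, strict for the filtrations by degree.
Induction on `m` then gives the Hilbert series (`hilbertSeries_eq`), the generators
(`span_generators`) and the relations (`exists_basis_relationModule`). The relations are triangular:
`P_m` lies in `Q_{m-1}(f)`, which expresses `δ ^ 2 P_m` through the other generators, and a symmetric
polynomial vanishing on the diagonal is divisible by `δ ^ 2`.

Both facts about `p_m` come down to one factor. Near each point of its regular set `f` is a constant
times a product of branches of `(x - a j) ^ b j` (`IsPowerProduct.eventually_eq`), and functions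
symmetric modulo `δ ^ (2 * m + 1)` form a ring (`IsSymmMod.mul`). Hence `P_m` may be taken to be a
product of polynomials adapted to the factors, and multiplication by such polynomials for the
exponents `-b i`, `i ≠ j`, isolates the factor `j`.

For `f = (x - a) ^ b` the problem is homogeneous at `(a, a)`, and a form of degree `d` corresponds to
a polynomial `q` in `w = (x - y) / (x + y - 2 * a)` of degree at most `d` such that
`(1 + w) ^ b * q w` is even up to order `2 * m + 1`, a problem of Padé type. A nonzero solution has
degree at least `d_m(b)` (`IsEvenMod.dExp_le_natDegree`): if the degree is less than `m`, the
Wronskian of the two sides, once the powers are divided out, is a polynomial of degree less than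
`2 * m` divisible by `w ^ (2 * m)`, hence zero, so that `q (-w) / q w` equals
`((1 + w) / (1 - w)) ^ b` up to a constant and `b` is an integer with `|b| ≤ deg q`. Conversely a
solution of degree at most `d_m(b)` with `q 0 = 1` exists (`exists_isEvenMod`): `(1 ∓ w) ^ |b|` for
integers `|b| ≤ m`, and otherwise by counting the `m` linear conditions.
-/

/-! ### A Padé problem in one variable -/

open Polynomial in
/-- The condition that `(1 + w) ^ b * q w` is even in `w` up to terms of order `2 * m + 1`, i.e.
that `q (-w) / q w` is a Padé-type approximation of `((1 + w) / (1 - w)) ^ b`. -/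
def IsEvenMod (m : ℕ) (b : ℂ) (q : ℂ[X]) : Prop :=
  ∃ k : ℂ → ℂ, AnalyticAt ℂ k 0 ∧ ∀ᶠ w in nhds (0 : ℂ),
    (1 + w) ^ b * q.eval w - (1 - w) ^ b * q.eval (-w) = w ^ (2 * m + 1) * k w

section OneVariable

open Polynomial Filter Topology

theorem Polynomial.X_pow_dvd_of_eventually_eq {p : ℂ[X]} {n : ℕ} {K : ℂ → ℂ}
    (hK : ContinuousAt K 0) (h : ∀ᶠ w in 𝓝[≠] (0 : ℂ), p.eval w = w ^ n * K w) :
    X ^ n ∣ p := by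
  induction n generalizing p with
  | zero => simp
  | succ n ih =>
    have h0 : p.eval 0 = 0 := by
      have h1 : Tendsto (fun w => p.eval w) (𝓝[≠] 0) (𝓝 (p.eval 0)) :=
        (p.continuous.tendsto 0).mono_left nhdsWithin_le_nhds
      have h2 : Tendsto (fun w : ℂ => w ^ (n + 1) * K w) (𝓝[≠] 0) (𝓝 (0 ^ (n + 1) * K 0)) :=
        (((continuous_pow (n + 1)).tendsto (0 : ℂ)).mul hK).mono_left nhdsWithin_le_nhds
      simpa using tendsto_nhds_unique h1 (h2.congr' (h.mono fun w hw => hw.symm))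
    obtain ⟨p', rfl⟩ : X ∣ p := by rwa [X_dvd_iff, coeff_zero_eq_eval_zero]
    rw [pow_succ']
    refine mul_dvd_mul_left _ (ih ?_)
    filter_upwards [h, self_mem_nhdsWithin] with w hw hw0
    refine mul_left_cancel₀ (show w ≠ 0 from hw0) ?_
    rw [eval_mul, eval_X] at hw
    rw [hw]; ring

theorem dExp_le (m : ℕ) (b : ℂ) : dExp m b ≤ m := by
  unfold dExp; split_ifs <;> simp

theorem dExp_intCast (m : ℕ) (z : ℤ) : dExp m (z : ℂ) = min m z.natAbs := by
  rw [dExp, if_pos ⟨z, rfl⟩, Complex.norm_intCast,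
    show |(z : ℝ)| = (z.natAbs : ℝ) by rw [Nat.cast_natAbs, Int.cast_abs], Nat.floor_natCast]

theorem dExp_zero (m : ℕ) : dExp m 0 = 0 := by
  simpa using dExp_intCast m 0

/-- The residue at `1` of the logarithmic derivative `q'/q - p'/p = -2b / (1 - X ^ 2)`. -/
theorem eq_rootMultiplicity_sub {q p : ℂ[X]} {b : ℂ} (hq : q ≠ 0) (hp : p ≠ 0)
    (h : (1 - X ^ 2) * (derivative q * p - q * derivative p) + C (2 * b) * (q * p) = 0) :
    b = (q.rootMultiplicity 1 : ℂ) - p.rootMultiplicity 1 := by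
  obtain ⟨q₁, hq₁, hq₁'⟩ := q.exists_eq_pow_rootMultiplicity_mul_and_not_dvd hq 1
  obtain ⟨p₁, hp₁, hp₁'⟩ := p.exists_eq_pow_rootMultiplicity_mul_and_not_dvd hp 1
  set e := q.rootMultiplicity 1
  set e' := p.rootMultiplicity 1
  have hd : ∀ (n : ℕ) (s : ℂ[X]), (X - C 1) * derivative ((X - C 1) ^ n * s)
      = (X - C 1) ^ n * (C (n : ℂ) * s + (X - C 1) * derivative s) := by
    intro n s
    rcases n with _ | n
    · simp
    · simp only [derivative_mul, derivative_X_sub_C_pow]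
      simp only [Nat.add_sub_cancel]
      push_cast
      ring
  have h1 := hd e q₁
  have h2 := hd e' p₁
  rw [← hq₁] at h1
  rw [← hp₁] at h2
  have h3 : (X - C 1) ^ (e + e') * (-(X + 1) * ((C (e : ℂ) * q₁ + (X - C 1) * derivative q₁) * p₁
      - q₁ * (C (e' : ℂ) * p₁ + (X - C 1) * derivative p₁)) + C (2 * b) * (q₁ * p₁)) = 0 := by
    have : (1 - X ^ 2 : ℂ[X]) = -(X + 1) * (X - C 1) := by
      simp only [map_one]; ring
    rw [this] at h
    calc _ = -(X + 1) * (((X - C 1) ^ e * (C (e : ℂ) * q₁ + (X - C 1) * derivative q₁))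
              * ((X - C 1) ^ e' * p₁)
            - ((X - C 1) ^ e * q₁)
              * ((X - C 1) ^ e' * (C (e' : ℂ) * p₁ + (X - C 1) * derivative p₁)))
          + C (2 * b) * (((X - C 1) ^ e * q₁) * ((X - C 1) ^ e' * p₁)) := by ring
      _ = -(X + 1) * (((X - C 1) * derivative q) * p - q * ((X - C 1) * derivative p))
          + C (2 * b) * (q * p) := by rw [← h1, ← h2, ← hq₁, ← hp₁]
      _ = 0 := by rw [← h]; ring
  have h4 := (mul_eq_zero.mp h3).resolve_left (pow_ne_zero _ (X_sub_C_ne_zero 1))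
  have h5 := congrArg (eval 1) h4
  rw [dvd_iff_isRoot, IsRoot.def] at hq₁' hp₁'
  simp only [eval_add, eval_mul, eval_neg, eval_X, eval_one, eval_sub, eval_C, eval_zero,
    sub_self, zero_mul, add_zero] at h5
  have h6 : 2 * (eval 1 q₁ * eval 1 p₁) * (b - (e - e')) = 0 := by linear_combination h5
  have h7 := (mul_eq_zero.mp h6).resolve_left
    (mul_ne_zero two_ne_zero (mul_ne_zero hq₁' hp₁'))
  linear_combination h7

theorem analyticAt_one_add_cpow_mul_eval (b : ℂ) (q : ℂ[X]) :
    AnalyticAt ℂ (fun w : ℂ => (1 + w) ^ b * q.eval w) 0 := by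
  have h1 : AnalyticAt ℂ (fun w : ℂ => (1 + w) ^ b) 0 :=
    (analyticAt_const.add analyticAt_id).cpow analyticAt_const (by simp)
  exact h1.mul (by simpa using (analyticAt_id (𝕜 := ℂ) (z := (0 : ℂ))).aeval_polynomial q)

/-- The Wronskian of `q` and `q (-X)`, twisted by `b`, vanishes to order `2 * m`, because it is a
multiple of the Wronskian of `(1 + w) ^ b * q w` and its image under `w ↦ -w`. -/
theorem IsEvenMod.X_pow_dvd {m : ℕ} {b : ℂ} {q : ℂ[X]} (h : IsEvenMod m b q) :
    X ^ (2 * m) ∣ (1 - X ^ 2) * (derivative q * q.comp (-X) - q * derivative (q.comp (-X)))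
      + C (2 * b) * (q * q.comp (-X)) := by
  obtain ⟨k, hk, h⟩ := h
  have hpos : ∀ᶠ w : ℂ in 𝓝 0, 1 + w ∈ Complex.slitPlane ∧ 1 - w ∈ Complex.slitPlane := by
    refine Filter.Eventually.and ?_ ?_
    · exact (continuous_const.add continuous_id).continuousAt.eventually_mem
        (Complex.isOpen_slitPlane.mem_nhds (by simp))
    · exact (continuous_const.sub continuous_id).continuousAt.eventually_mem
        (Complex.isOpen_slitPlane.mem_nhds (by simp))
  have hβ : ContinuousAt (fun w : ℂ => (1 - w) ^ b) 0 :=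
    ((analyticAt_const.sub analyticAt_id).cpow analyticAt_const (by simp)).continuousAt
  -- `(1 + w)` times the derivative of `(1 + w) ^ b * q w`, divided by `(1 + w) ^ b`
  let B : ℂ → ℂ := fun w => b * q.eval w + (1 + w) * (derivative q).eval w
  have hB : Continuous B := by fun_prop
  refine X_pow_dvd_of_eventually_eq (K := fun w =>
    (1 - w) * (((1 + w) * ((2 * m + 1) * k w + w * deriv k w)) * q.eval w
      - w * k w * B w) / (1 - w) ^ b) ?_ ?_
  · refine ContinuousAt.div ?_ hβ (by simp)
    have := hk.continuousAt
    have := hk.deriv.continuousAt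
    have := hB.continuousAt (x := 0)
    have : ContinuousAt (fun w => q.eval w) 0 := q.continuous.continuousAt
    fun_prop
  · refine Filter.Eventually.filter_mono nhdsWithin_le_nhds ?_
    filter_upwards [h, h.eventually_nhds, hpos, hk.eventually_analyticAt] with w hw hw' ⟨hp, hn⟩ hkw
    have ha : (1 + w) ≠ 0 := Complex.slitPlane_ne_zero hp
    have hb : (1 - w) ≠ 0 := Complex.slitPlane_ne_zero hn
    have ha' : (1 + w) ^ b ≠ 0 := by simp [Complex.cpow_eq_zero_iff, ha]
    have hb' : (1 - w) ^ b ≠ 0 := by simp [Complex.cpow_eq_zero_iff, hb]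
    have d1 : HasDerivAt (fun w : ℂ => (1 + w) ^ b) (b * (1 + w) ^ (b - 1) * 1) w :=
      ((hasDerivAt_id w).const_add 1).cpow_const hp
    have d2 : HasDerivAt (fun w : ℂ => (1 - w) ^ b) (b * (1 - w) ^ (b - 1) * (-1)) w :=
      ((hasDerivAt_id w).const_sub 1).cpow_const hn
    rw [Complex.cpow_sub _ _ ha, Complex.cpow_one] at d1
    rw [Complex.cpow_sub _ _ hb, Complex.cpow_one] at d2
    have d3 : HasDerivAt (fun w => q.eval (-w)) ((derivative q).eval (-w) * (-1)) w :=
      (q.hasDerivAt (-w)).comp w (hasDerivAt_neg w)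
    have dL := (d1.mul (q.hasDerivAt w)).sub (d2.mul d3)
    have dR := (hasDerivAt_pow (2 * m + 1) w).mul hkw.differentiableAt.hasDerivAt
    have hD := (dL.congr_of_eventuallyEq (hw'.mono fun v hv => hv.symm)).unique dR
    simp only [Nat.add_sub_cancel] at hD
    push_cast at hD
    simp only [eval_add, eval_mul, eval_sub, eval_one, eval_pow, eval_X, eval_C, eval_comp,
      eval_neg, derivative_comp, derivative_neg, derivative_X]
    simp only [B]
    generalize (1 + w) ^ b = α at *
    generalize (1 - w) ^ b = β at *
    generalize eval w q = Q at *
    generalize eval (-w) q = Q' at *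
    generalize eval w (derivative q) = R at *
    generalize eval (-w) (derivative q) = R' at *
    generalize k w = κ at *
    generalize deriv k w = κ' at *
    rw [pow_succ] at hD hw
    generalize w ^ (2 * m) = t at *
    field_simp at hD
    field_simp
    refine mul_left_cancel₀ ha' ?_
    linear_combination (Q * α) * hD - (1 - w) * α * (b * Q + (1 + w) * R) * hw

/-- If `(1 + w) ^ b * q w` is even up to order `2 * m + 1` then `q` has degree at least
`d_m(b)`: otherwise the twisted Wronskian of `q` and `q (-X)`, which has degree less than `2 * m`,
is zero, and `b` is the difference of the multiplicities of `1` and `-1` as roots of `q`. -/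
theorem IsEvenMod.dExp_le_natDegree {m : ℕ} {b : ℂ} {q : ℂ[X]} (hq : q ≠ 0)
    (h : IsEvenMod m b q) : dExp m b ≤ q.natDegree := by
  by_contra! hlt
  have hlt' : q.natDegree < m := hlt.trans_le (dExp_le m b)
  have hcd : (q.comp (-X)).natDegree = q.natDegree := by
    rw [natDegree_comp]; simp
  have hcomp : q.comp (-X) ≠ 0 := by
    intro h0
    have := congrArg (fun p => p.comp (-X)) h0
    simp only [comp_assoc, neg_comp, X_comp, neg_neg, comp_X, zero_comp] at this
    exact hq this
  have h0 := h.X_pow_dvd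
  have hdeg : ((1 - X ^ 2) * (derivative q * q.comp (-X) - q * derivative (q.comp (-X)))
      + C (2 * b) * (q * q.comp (-X))).natDegree ≤ 2 * q.natDegree + 1 := by
    have hX : (1 - X ^ 2 : ℂ[X]).natDegree ≤ 2 := by compute_degree
    have h1 : ∀ p : ℂ[X], (derivative p).natDegree ≤ p.natDegree - 1 := natDegree_derivative_le
    rcases Nat.eq_zero_or_pos q.natDegree with hz | hz
    · have e1 : derivative q = 0 := by
        rw [eq_C_of_natDegree_eq_zero hz]; simp
      have e2 : derivative (q.comp (-X)) = 0 := by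
        rw [eq_C_of_natDegree_eq_zero (hcd.trans hz)]; simp
      rw [e1, e2]
      simp only [zero_mul, mul_zero, sub_zero, zero_add]
      refine (natDegree_C_mul_le _ _).trans (natDegree_mul_le.trans ?_)
      omega
    · refine natDegree_add_le_of_degree_le ?_ ?_
      · refine natDegree_mul_le.trans ?_
        have : (derivative q * q.comp (-X) - q * derivative (q.comp (-X))).natDegree
            ≤ 2 * q.natDegree - 1 := by
          refine (natDegree_sub_le _ _).trans (max_le ?_ ?_)
          · refine natDegree_mul_le.trans ?_
            have := h1 q
            omega
          · refine natDegree_mul_le.trans ?_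
            have := h1 (q.comp (-X))
            omega
        omega
      · refine (natDegree_C_mul_le _ _).trans (natDegree_mul_le.trans ?_)
        omega
  have hW := eq_zero_of_dvd_of_natDegree_lt h0 (by rw [natDegree_X_pow]; omega)
  have hb := eq_rootMultiplicity_sub hq hcomp hW
  have e1 : q.rootMultiplicity 1 ≤ q.natDegree := by
    rw [← count_roots]
    exact (Multiset.count_le_card _ _).trans (card_roots' _)
  have e2 : (q.comp (-X)).rootMultiplicity 1 ≤ q.natDegree := by
    rw [← hcd, ← count_roots]
    exact (Multiset.count_le_card _ _).trans (card_roots' _)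
  have hb' : b = (((q.rootMultiplicity 1 : ℤ) - (q.comp (-X)).rootMultiplicity 1 : ℤ) : ℂ) := by
    rw [hb]; push_cast; rfl
  rw [hb', dExp_intCast] at hlt
  omega

/-- The even Taylor coefficients of `A w - A (-w)` vanish automatically, which leaves `m`
conditions. -/
theorem isEvenMod_iff {m : ℕ} {b : ℂ} {q : ℂ[X]} :
    IsEvenMod m b q ↔ ∀ j < m, iteratedDeriv (2 * j + 1)
      (fun w : ℂ => (1 + w) ^ b * q.eval w) 0 = 0 := by
  have hA := analyticAt_one_add_cpow_mul_eval b q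
  set A : ℂ → ℂ := fun w : ℂ => (1 + w) ^ b * q.eval w with hAdef
  have hA' : AnalyticAt ℂ (fun w => A (-w)) 0 :=
    AnalyticAt.fun_comp (by simpa using hA) analyticAt_id.neg
  have key : ∀ i, iteratedDeriv i (fun w => A w - A (-w)) 0
      = (1 - (-1) ^ i) * iteratedDeriv i A 0 := by
    intro i
    rw [iteratedDeriv_fun_sub hA.contDiffAt hA'.contDiffAt, iteratedDeriv_comp_neg]
    simp [sub_mul]
  have h1 := natCast_le_analyticOrderAt (hA.fun_sub hA') (n := 2 * m + 1)
  rw [natCast_le_analyticOrderAt_iff_iteratedDeriv_eq_zero (hA.fun_sub hA')] at h1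
  have h2 : IsEvenMod m b q ↔ ∀ i < 2 * m + 1, iteratedDeriv i (fun w => A w - A (-w)) 0 = 0 := by
    rw [h1]
    simp only [IsEvenMod, hAdef, sub_zero, smul_eq_mul, ← sub_eq_add_neg]
  rw [h2]
  constructor
  · intro h j hj
    have := h (2 * j + 1) (by omega)
    rw [key, Odd.neg_one_pow ⟨j, rfl⟩] at this
    norm_num at this
    exact this
  · intro h i hi
    rw [key]
    rcases Nat.even_or_odd' i with ⟨j, rfl | rfl⟩
    · simp
    · rw [h j (by omega), mul_zero]

/-- The Padé problem `(1 + w) ^ b * q w` even up to order `2 * m + 1` consists of `m` linear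
equations, so that it has a nonzero solution of degree at most `m`. -/
theorem exists_isEvenMod_natDegree_le (m : ℕ) (b : ℂ) :
    ∃ q : ℂ[X], q ≠ 0 ∧ q.natDegree ≤ m ∧ IsEvenMod m b q := by
  let Φ : degreeLT ℂ (m + 1) →ₗ[ℂ] (Fin m → ℂ) :=
    { toFun := fun q j => iteratedDeriv (2 * j + 1)
        (fun w : ℂ => (1 + w) ^ b * (q : ℂ[X]).eval w) 0
      map_add' := by
        intro p q
        funext j
        rw [Pi.add_apply, ← iteratedDeriv_fun_add
          (analyticAt_one_add_cpow_mul_eval b _).contDiffAt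
          (analyticAt_one_add_cpow_mul_eval b _).contDiffAt]
        simp [mul_add]
      map_smul' := by
        intro c q
        funext j
        simp only [RingHom.id_apply, Pi.smul_apply, smul_eq_mul]
        rw [← iteratedDeriv_const_mul_field]
        simp [mul_left_comm] }
  have hfin : Module.Finite ℂ (degreeLT ℂ (m + 1)) :=
    Module.Finite.equiv (degreeLTEquiv ℂ (m + 1)).symm
  have hker : LinearMap.ker Φ ≠ ⊥ := by
    refine LinearMap.ker_ne_bot_of_finrank_lt ?_
    rw [(degreeLTEquiv ℂ (m + 1)).finrank_eq]
    simp
  obtain ⟨q, hq, hq0⟩ := (Submodule.ne_bot_iff _).mp hker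
  have hq0' : (q : ℂ[X]) ≠ 0 := by simpa using hq0
  refine ⟨q, hq0', ?_, isEvenMod_iff.mpr fun j hj => ?_⟩
  · have := (natDegree_lt_iff_degree_lt hq0').mpr (mem_degreeLT.mp q.2)
    omega
  · exact congrFun (LinearMap.mem_ker.mp hq) ⟨j, hj⟩

/-- The constant and the linear coefficient of a solution of the Padé problem vanish together. -/
theorem IsEvenMod.X_dvd_of_dvd {m : ℕ} {b : ℂ} {r : ℂ[X]} (h : IsEvenMod (m + 1) b (X * r)) :
    X ∣ r := by
  obtain ⟨k, hk, h⟩ := h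
  have hc : ContinuousAt (fun w : ℂ => (1 + w) ^ b * r.eval w + (1 - w) ^ b * r.eval (-w)) 0 := by
    have h1 := (analyticAt_one_add_cpow_mul_eval b r).continuousAt
    have h2 : ContinuousAt (fun w : ℂ => (1 - w) ^ b * r.eval (-w)) 0 := by
      have := ContinuousAt.comp (f := fun w : ℂ => -w) (x := 0)
        (g := fun w : ℂ => (1 + w) ^ b * r.eval w) (by simpa using h1) continuousAt_neg
      simpa only [Function.comp_def, ← sub_eq_add_neg] using this
    exact h1.add h2
  have e : (fun w : ℂ => (1 + w) ^ b * r.eval w + (1 - w) ^ b * r.eval (-w))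
      =ᶠ[𝓝[≠] 0] fun w => w ^ (2 * m + 2) * k w := by
    filter_upwards [h.filter_mono nhdsWithin_le_nhds, self_mem_nhdsWithin] with w hw hw0
    refine mul_left_cancel₀ (show w ≠ 0 from hw0) ?_
    simp only [eval_mul, eval_X] at hw
    linear_combination hw
  have h2 : Tendsto (fun w : ℂ => w ^ (2 * m + 2) * k w) (𝓝[≠] 0)
      (𝓝 (0 ^ (2 * m + 2) * k 0)) :=
    (((continuous_pow (2 * m + 2)).tendsto (0 : ℂ)).mul hk.continuousAt).mono_left
      nhdsWithin_le_nhds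
  have h3 := tendsto_nhds_unique (hc.tendsto.mono_left nhdsWithin_le_nhds) (h2.congr' e.symm)
  rw [X_dvd_iff, coeff_zero_eq_eval_zero]
  simp at h3
  exact h3

theorem IsEvenMod.of_X_sq_mul {m : ℕ} {b : ℂ} {s : ℂ[X]} (h : IsEvenMod (m + 1) b (X ^ 2 * s)) :
    IsEvenMod m b s := by
  obtain ⟨k, hk, h⟩ := h
  refine ⟨k, hk, ?_⟩
  filter_upwards [h] with w hw
  rcases eq_or_ne w 0 with rfl | hw0
  · simp
  · refine mul_left_cancel₀ (pow_ne_zero 2 hw0) ?_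
    simp only [eval_mul, eval_X, eval_pow] at hw
    linear_combination hw

theorem IsEvenMod.C_mul {m : ℕ} {b : ℂ} {q : ℂ[X]} (h : IsEvenMod m b q) (c : ℂ) :
    IsEvenMod m b (C c * q) := by
  obtain ⟨k, hk, h⟩ := h
  refine ⟨fun w => c * k w, analyticAt_const.mul hk, ?_⟩
  filter_upwards [h] with w hw
  simp only [eval_mul, eval_C]
  linear_combination c * hw

/-- A solution of minimal degree cannot vanish at `0`: it would be `X ^ 2 * s`, with `s` a solution
for `m - 1` of degree at most `m - 2`, below the bound `d_{m-1}(b) = m - 1`. -/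
theorem exists_isEvenMod_of_dExp_eq {m : ℕ} {b : ℂ} (h : ∀ n ≤ m, dExp n b = n) :
    ∃ q : ℂ[X], q.natDegree ≤ m ∧ q.eval 0 = 1 ∧ IsEvenMod m b q := by
  obtain ⟨q, hq, hd, hE⟩ := exists_isEvenMod_natDegree_le m b
  have h0 : q.eval 0 ≠ 0 := by
    intro h0
    obtain ⟨r, rfl⟩ : X ∣ q := by rwa [X_dvd_iff, coeff_zero_eq_eval_zero]
    rcases m with _ | m
    · rw [natDegree_X_mul (right_ne_zero_of_mul hq)] at hd
      omega
    obtain ⟨s, rfl⟩ := hE.X_dvd_of_dvd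
    have hs : s ≠ 0 := right_ne_zero_of_mul (right_ne_zero_of_mul hq)
    rw [natDegree_X_mul (right_ne_zero_of_mul hq), natDegree_X_mul hs] at hd
    rw [← mul_assoc, ← sq] at hE
    have := hE.of_X_sq_mul.dExp_le_natDegree hs
    rw [h m (by omega)] at this
    omega
  refine ⟨C (q.eval 0)⁻¹ * q, (natDegree_C_mul_le _ _).trans hd, ?_, hE.C_mul _⟩
  simp [h0]

/-- The polynomials realizing the minimal degree `d_m(b)`. For an integer `b` with `|b| ≤ m` this
is `(1 ∓ X) ^ |b|`, and otherwise a Padé approximant. -/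
theorem exists_isEvenMod (m : ℕ) (b : ℂ) :
    ∃ q : ℂ[X], q.natDegree ≤ dExp m b ∧ q.eval 0 = 1 ∧ IsEvenMod m b q := by
  by_cases hb : b ∈ Set.range ((↑) : ℤ → ℂ)
  · obtain ⟨z, rfl⟩ := hb
    rcases le_total z.natAbs m with hz | hz
    · rw [dExp_intCast, min_eq_right hz]
      obtain ⟨n, rfl | rfl⟩ := z.eq_nat_or_neg
      · refine ⟨(1 - X) ^ n, ?_, by simp, 0, analyticAt_const, .of_forall fun w => ?_⟩
        · simpa using natDegree_pow_le_of_le n (show (1 - X : ℂ[X]).natDegree ≤ 1 by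
            compute_degree)
        · simp; ring
      · refine ⟨(1 + X) ^ n, ?_, by simp, 0, analyticAt_const, ?_⟩
        · simpa using natDegree_pow_le_of_le n (show (1 + X : ℂ[X]).natDegree ≤ 1 by
            compute_degree)
        · have h1 : ∀ᶠ w : ℂ in 𝓝 0, 1 + w ≠ 0 :=
            (continuous_const.add continuous_id).continuousAt.eventually_ne (by simp)
          have h2 : ∀ᶠ w : ℂ in 𝓝 0, 1 - w ≠ 0 :=
            (continuous_const.sub continuous_id).continuousAt.eventually_ne (by simp)
          filter_upwards [h1, h2] with w hw1 hw2
          simp only [Int.cast_neg, Int.cast_natCast, Complex.cpow_neg, Complex.cpow_natCast,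
            eval_pow, eval_add, eval_one, eval_X, ← sub_eq_add_neg, Pi.zero_apply, mul_zero]
          rw [inv_mul_cancel₀ (pow_ne_zero _ hw1), inv_mul_cancel₀ (pow_ne_zero _ hw2), sub_self]
    · have := exists_isEvenMod_of_dExp_eq (m := m) (b := z) fun n hn => by
        rw [dExp_intCast]; omega
      rwa [dExp_intCast, min_eq_left hz]
  · have hd : ∀ n, dExp n b = n := fun n => by rw [dExp, if_neg hb]
    rw [hd]
    exact exists_isEvenMod_of_dExp_eq fun n _ => hd n

end OneVariable

/-! ### Functions symmetric modulo a power of `x - y` -/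

/-- Restriction of a polynomial in two variables to the diagonal `x = y`. -/
noncomputable abbrev diag : MvPolynomial (Fin 2) ℂ →ₐ[ℂ] Polynomial ℂ :=
  MvPolynomial.aeval ![Polynomial.X, Polynomial.X]

/-- `Φ` is smooth at the diagonal point `(u₀, u₀)`, and near this point it is symmetric modulo
`(x - y) ^ (2 * m + 1)` in the ring of smooth functions. -/
def IsSymmMod (m : ℕ) (u₀ : ℂ) (Φ : ℂ × ℂ → ℂ) : Prop :=
  ContDiffAt ℂ ∞ Φ (u₀, u₀) ∧ ∃ g : ℂ × ℂ → ℂ, ContDiffAt ℂ ∞ g (u₀, u₀) ∧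
    ∀ᶠ p in nhds (u₀, u₀), Φ p - Φ p.swap = (p.1 - p.2) ^ (2 * m + 1) * g p

section Germs

open Polynomial Filter Topology

theorem contDiff_eval_pair (P : MvPolynomial (Fin 2) ℂ) :
    ContDiff ℂ ∞ (fun p : ℂ × ℂ => MvPolynomial.eval ![p.1, p.2] P) := by
  induction P using MvPolynomial.induction_on with
  | C c => simpa using contDiff_const
  | add P P' h h' => simpa using h.add h'
  | mul_X P i h =>
    simp only [map_mul, MvPolynomial.eval_X]
    refine h.mul ?_
    fin_cases i
    · exact contDiff_fst
    · exact contDiff_snd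

theorem tendsto_swap_diagonal (u : ℂ) : Tendsto Prod.swap (𝓝 (u, u)) (𝓝 (u, u)) :=
  continuous_swap.tendsto (u, u)

theorem isSymmMod_const (m : ℕ) (u c : ℂ) : IsSymmMod m u fun _ => c :=
  ⟨contDiffAt_const, fun _ => 0, contDiffAt_const, .of_forall fun p => by simp⟩

theorem IsSymmMod.congr {m : ℕ} {u : ℂ} {Φ Ψ : ℂ × ℂ → ℂ} (h : IsSymmMod m u Φ)
    (e : Φ =ᶠ[𝓝 (u, u)] Ψ) : IsSymmMod m u Ψ := by
  obtain ⟨hΦ, g, hg, h⟩ := h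
  refine ⟨hΦ.congr_of_eventuallyEq e.symm, g, hg, ?_⟩
  filter_upwards [h, e, (tendsto_swap_diagonal u).eventually e] with p h1 h2 h3
  rw [← h2, ← h3, h1]

theorem IsSymmMod.mul {m : ℕ} {u : ℂ} {Φ Ψ : ℂ × ℂ → ℂ} (h : IsSymmMod m u Φ)
    (h' : IsSymmMod m u Ψ) : IsSymmMod m u fun p => Φ p * Ψ p := by
  obtain ⟨hΦ, g, hg, h⟩ := h
  obtain ⟨hΨ, g', hg', h'⟩ := h'
  have hs : ContDiffAt ℂ ∞ (fun p : ℂ × ℂ => Ψ p.swap) (u, u) :=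
    ContDiffAt.comp (f := Prod.swap) (u, u) hΨ (contDiff_snd.prodMk contDiff_fst).contDiffAt
  refine ⟨hΦ.mul hΨ, fun p => Φ p * g' p + Ψ p.swap * g p, (hΦ.mul hg').add (hs.mul hg), ?_⟩
  filter_upwards [h, h'] with p h1 h2
  linear_combination Φ p * h2 + Ψ p.swap * h1

theorem IsSymmMod.prod {ι : Type*} {m : ℕ} {u : ℂ} (s : Finset ι) {Φ : ι → ℂ × ℂ → ℂ}
    (h : ∀ i ∈ s, IsSymmMod m u (Φ i)) : IsSymmMod m u fun p => ∏ i ∈ s, Φ i p := by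
  classical
  induction s using Finset.induction_on with
  | empty => simpa using isSymmMod_const m u 1
  | insert i s hi ih =>
    simp only [Finset.prod_insert hi]
    exact (h i (Finset.mem_insert_self i s)).mul
      (ih fun j hj => h j (Finset.mem_insert_of_mem hj))

theorem Complex.mul_cpow_of_re_pos {x y : ℂ} (hx : 0 < x.re) (hy : 0 < y.re) (b : ℂ) :
    (x * y) ^ b = x ^ b * y ^ b := by
  have hx0 : x ≠ 0 := fun h => by simp [h] at hx
  have hy0 : y ≠ 0 := fun h => by simp [h] at hy
  have h1 := abs_lt.mp (Complex.abs_arg_lt_pi_div_two_iff.mpr (.inl hx))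
  have h2 := abs_lt.mp (Complex.abs_arg_lt_pi_div_two_iff.mpr (.inl hy))
  rw [Complex.cpow_def_of_ne_zero (mul_ne_zero hx0 hy0), Complex.cpow_def_of_ne_zero hx0,
    Complex.cpow_def_of_ne_zero hy0, Complex.log_mul hx0 hy0 ⟨by linarith, by linarith⟩, add_mul,
    Complex.exp_add]

theorem eventually_re_pos {E : Type*} [TopologicalSpace E] {f : E → ℂ} {x : E}
    (hf : ContinuousAt f x) (h : f x = 1) : ∀ᶠ y in 𝓝 x, 0 < (f y).re :=
  (Complex.continuous_re.continuousAt.comp hf).eventually_const_lt (by simp [h])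

/-- The polynomial `u ^ d * q (v / u)`, for `u = (x + y) / 2 - a` and `v = (x - y) / 2`: the
homogenization of `q` in degree `d`, centred at `(a, a)`. -/
noncomputable def homogenizeAt (a : ℂ) (d : ℕ) (q : ℂ[X]) : MvPolynomial (Fin 2) ℂ :=
  ∑ i ∈ Finset.range (d + 1), MvPolynomial.C (q.coeff i)
    * ((MvPolynomial.C (1 / 2) * (MvPolynomial.X 0 - MvPolynomial.X 1)) ^ i
    * (MvPolynomial.C (1 / 2) * (MvPolynomial.X 0 + MvPolynomial.X 1) - MvPolynomial.C a)
      ^ (d - i))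

theorem totalDegree_homogenizeAt_le (a : ℂ) (d : ℕ) (q : ℂ[X]) :
    (homogenizeAt a d q).totalDegree ≤ d := by
  have hX : ∀ i : Fin 2, (MvPolynomial.X i : MvPolynomial (Fin 2) ℂ).totalDegree ≤ 1 :=
    fun i => (MvPolynomial.totalDegree_X i).le
  have hC : ∀ (c : ℂ) (P : MvPolynomial (Fin 2) ℂ),
      (MvPolynomial.C c * P).totalDegree ≤ P.totalDegree := fun c P =>
    (MvPolynomial.totalDegree_mul _ _).trans (by rw [MvPolynomial.totalDegree_C, zero_add])
  refine (MvPolynomial.totalDegree_finsetSum _ _).trans (Finset.sup_le fun i hi => ?_)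
  have hi' := Finset.mem_range.mp hi
  refine (hC _ _).trans ((MvPolynomial.totalDegree_mul _ _).trans ?_)
  have h1 := (MvPolynomial.totalDegree_pow (MvPolynomial.C (1 / 2 : ℂ)
    * (MvPolynomial.X 0 - MvPolynomial.X 1) : MvPolynomial (Fin 2) ℂ) i).trans
    (Nat.mul_le_mul_left i ((hC _ _).trans ((MvPolynomial.totalDegree_sub _ _).trans
      (max_le (hX 0) (hX 1)))))
  have h2 := (MvPolynomial.totalDegree_pow (MvPolynomial.C (1 / 2 : ℂ)
    * (MvPolynomial.X 0 + MvPolynomial.X 1) - MvPolynomial.C a : MvPolynomial (Fin 2) ℂ)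
      (d - i)).trans
    (Nat.mul_le_mul_left (d - i) ((MvPolynomial.totalDegree_sub _ _).trans
      (max_le ((hC _ _).trans ((MvPolynomial.totalDegree_add _ _).trans
        (max_le (hX 0) (hX 1)))) (by simp))))
  omega

theorem diag_homogenizeAt (a : ℂ) (d : ℕ) (q : ℂ[X]) :
    diag (homogenizeAt a d q) = C (q.eval 0) * (X - C a) ^ d := by
  have h2 : (C (1 / 2 : ℂ) * (X + X) : ℂ[X]) = X := by
    rw [← two_mul, ← mul_assoc, show (2 : ℂ[X]) = C 2 from rfl, ← C_mul]; simp
  simp only [diag, homogenizeAt, map_sum, map_mul, map_pow, map_sub, map_add,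
    MvPolynomial.aeval_X, MvPolynomial.aeval_C, Matrix.cons_val_zero, Matrix.cons_val_one,
    sub_self, mul_zero, algebraMap_eq]
  rw [Finset.sum_eq_single 0]
  · rw [h2, ← coeff_zero_eq_eval_zero]; simp
  · intro i _ hi
    simp [hi]
  · simp

theorem eval_homogenizeAt {a : ℂ} {d : ℕ} {q : ℂ[X]} (hd : q.natDegree ≤ d) {x y : ℂ}
    (hu : (x + y) / 2 - a ≠ 0) :
    MvPolynomial.eval ![x, y] (homogenizeAt a d q)
      = ((x + y) / 2 - a) ^ d * q.eval ((x - y) / 2 / ((x + y) / 2 - a)) := by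
  rw [eval_eq_sum_range' (Nat.lt_succ_of_le hd), Finset.mul_sum]
  simp only [homogenizeAt, map_sum, map_mul, map_pow, map_sub, map_add, MvPolynomial.eval_X,
    MvPolynomial.eval_C, Matrix.cons_val_zero, Matrix.cons_val_one]
  refine Finset.sum_congr rfl fun i hi => ?_
  have hi' : i ≤ d := Nat.lt_succ_iff.mp (Finset.mem_range.mp hi)
  rw [div_pow, ← Nat.sub_add_cancel hi', pow_add, Nat.add_sub_cancel,
    mul_assoc ((_ : ℂ) ^ (d - i)), mul_left_comm ((_ : ℂ) ^ i) (q.coeff i),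
    mul_div_cancel₀ _ (pow_ne_zero i hu)]
  ring

/-- In the coordinates `u` and `w = v / u`, antisymmetrizing `(x - a) ^ b * u ^ d * q w` gives
`u ^ (b + d) * ((1 + w) ^ b * q w - (1 - w) ^ b * q (-w))`. -/
theorem isSymmMod_homogenizeAt {m d : ℕ} {a b u₀ : ℂ} {q : ℂ[X]} (hd : q.natDegree ≤ d)
    (hq : IsEvenMod m b q) (hu : u₀ ≠ a) :
    IsSymmMod m u₀ fun p => ((p.1 - a) / (u₀ - a)) ^ b
      * MvPolynomial.eval ![p.1, p.2] (homogenizeAt a d q) := by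
  obtain ⟨k, hk, h⟩ := hq
  have hu' : u₀ - a ≠ 0 := sub_ne_zero.mpr hu
  -- the coordinates `u = (x + y) / 2 - a` and `w = (x - y) / (2 * u)`
  set U : ℂ × ℂ → ℂ := fun p => (p.1 + p.2) / 2 - a with hU
  set W : ℂ × ℂ → ℂ := fun p => (p.1 - p.2) / 2 / U p with hW
  have hU0 : U (u₀, u₀) = u₀ - a := by simp only [hU]; ring
  have hW0 : W (u₀, u₀) = 0 := by simp [hW]
  have a1 : AnalyticAt ℂ (fun p : ℂ × ℂ => p.1) (u₀, u₀) := analyticAt_fst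
  have a2 : AnalyticAt ℂ (fun p : ℂ × ℂ => p.2) (u₀, u₀) := analyticAt_snd
  have aU : AnalyticAt ℂ U (u₀, u₀) := (a1.add a2).div_const.sub analyticAt_const
  have aW : AnalyticAt ℂ W (u₀, u₀) := by
    refine AnalyticAt.div (a1.sub a2).div_const aU (by rwa [hU0])
  have aR : AnalyticAt ℂ (fun p => (U p / (u₀ - a)) ^ b) (u₀, u₀) := by
    refine AnalyticAt.cpow (aU.div analyticAt_const hu') analyticAt_const ?_
    rw [hU0, div_self hu']
    simp
  have ak : AnalyticAt ℂ (fun p => k (W p)) (u₀, u₀) :=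
    AnalyticAt.fun_comp (by rwa [hW0]) aW
  have hne : ∀ᶠ p in 𝓝 (u₀, u₀), U p ≠ 0 :=
    aU.continuousAt.eventually_ne (by rwa [hU0])
  have hWt : Tendsto W (𝓝 (u₀, u₀)) (𝓝 0) := by
    simpa [hW0] using aW.continuousAt.tendsto
  refine ⟨?_, fun p => (U p / (u₀ - a)) ^ b * U p ^ d * k (W p) / (2 * U p) ^ (2 * m + 1), ?_, ?_⟩
  · refine ContDiffAt.mul ?_ (contDiff_eval_pair _).contDiffAt
    refine AnalyticAt.contDiffAt (AnalyticAt.cpow (a1.sub analyticAt_const).div_const analyticAt_const ?_)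
    simp [div_self hu']
  · refine AnalyticAt.contDiffAt (AnalyticAt.div ((aR.mul (aU.pow d)).mul ak)
      ((analyticAt_const.mul aU).pow _) ?_)
    rw [hU0]
    exact pow_ne_zero _ (mul_ne_zero two_ne_zero hu')
  · have r1 : ∀ᶠ p in 𝓝 (u₀, u₀), 0 < (U p / (u₀ - a)).re :=
      eventually_re_pos (aU.continuousAt.div_const _) (by rw [hU0, div_self hu'])
    have r2 : ∀ᶠ p in 𝓝 (u₀, u₀), 0 < (1 + W p).re :=
      eventually_re_pos (continuousAt_const.add aW.continuousAt) (by rw [hW0, add_zero])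
    have r3 : ∀ᶠ p in 𝓝 (u₀, u₀), 0 < (1 - W p).re :=
      eventually_re_pos (continuousAt_const.sub aW.continuousAt) (by rw [hW0, sub_zero])
    filter_upwards [hne, hWt.eventually h, r1, r2, r3] with p hp hk h1 h2 h3
    have hs : ((p.2 + p.1) / 2 - a) = U p := by simp only [hU]; ring
    have hx : (p.1 - a) / (u₀ - a) = U p / (u₀ - a) * (1 + W p) := by
      have : p.1 - a = U p * (1 + W p) := by
        simp only [hW]; field_simp; simp only [hU]; ring
      rw [this]; ring
    have hy : (p.2 - a) / (u₀ - a) = U p / (u₀ - a) * (1 - W p) := by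
      have : p.2 - a = U p * (1 - W p) := by
        simp only [hW]; field_simp; simp only [hU]; ring
      rw [this]; ring
    have hw : p.1 - p.2 = W p * (2 * U p) := by simp only [hW]; field_simp
    have hw' : (p.2 - p.1) / 2 / U p = - W p := by simp only [hW]; ring
    have e1 : MvPolynomial.eval ![p.1, p.2] (homogenizeAt a d q) = U p ^ d * q.eval (W p) :=
      eval_homogenizeAt hd hp
    have e2 : MvPolynomial.eval ![p.2, p.1] (homogenizeAt a d q) = U p ^ d * q.eval (-W p) := by
      rw [eval_homogenizeAt hd (by rwa [hs]), hs, hw']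
    simp only [Prod.fst_swap, Prod.snd_swap]
    rw [e1, e2, hx, hy, Complex.mul_cpow_of_re_pos h1 h2, Complex.mul_cpow_of_re_pos h1 h3, hw,
      mul_pow, mul_assoc (W p ^ (2 * m + 1)), mul_div_cancel₀ _ (pow_ne_zero _
        (mul_ne_zero two_ne_zero hp))]
    linear_combination ((U p / (u₀ - a)) ^ b * U p ^ d) * hk

/-- The minimal quasi-invariant for one factor `(x - a) ^ b`. -/
theorem exists_isSymmMod_factor (m : ℕ) (a b : ℂ) :
    ∃ P : MvPolynomial (Fin 2) ℂ, P.totalDegree ≤ dExp m b ∧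
      diag P = (X - C a) ^ dExp m b ∧
      ∀ u₀, (b ≠ 0 → u₀ ≠ a) → IsSymmMod m u₀ fun p => ((p.1 - a) / (u₀ - a)) ^ b
        * MvPolynomial.eval ![p.1, p.2] P := by
  rcases eq_or_ne b 0 with rfl | hb
  · rw [dExp_zero]
    exact ⟨1, by simp, by simp, fun u₀ _ => by simpa using isSymmMod_const m u₀ 1⟩
  · obtain ⟨q, hd, hq0, hq⟩ := exists_isEvenMod m b
    refine ⟨homogenizeAt a (dExp m b) q, totalDegree_homogenizeAt_le _ _ _, ?_,
      fun u₀ hu => isSymmMod_homogenizeAt hd hq (hu hb)⟩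
    rw [diag_homogenizeAt, hq0, C_1, one_mul]
end Germs

/-! ### Quasi-invariants and their restrictions to the diagonal -/

section LocalForm

open Polynomial Filter Topology

theorem isOpen_regularSet (f : ℂ → ℂ) : IsOpen (regularSet f) := by
  rw [isOpen_iff_mem_nhds]
  rintro z ⟨h1, h2⟩
  exact h1.eventually_analyticAt.and (h1.continuousAt.eventually_ne h2)

/-- Near a point of its regular set, `f` is a constant multiple of the product of the principal
branches of the factors. The quotient is continuous, and its values lie in the countable set of
possible quotients of two determinations, so that it is constant on discs. -/
theorem IsPowerProduct.eventually_eq {k : ℕ} {a b : Fin k → ℂ} {f : ℂ → ℂ}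
    (hf : IsPowerProduct a b f) {u₀ : ℂ} (hu : u₀ ∈ regularSet f) :
    (∀ j, b j ≠ 0 → u₀ ≠ a j) ∧
      ∀ᶠ x in 𝓝 u₀, f x = f u₀ * ∏ j, ((x - a j) / (u₀ - a j)) ^ b j := by
  have hne : ∀ j, b j ≠ 0 → u₀ ≠ a j := by
    intro j hj h
    obtain ⟨L, hL, -⟩ := hf.2 u₀ hu
    exact Complex.exp_ne_zero (L j) (by rw [hL j hj, h, sub_self])
  refine ⟨hne, ?_⟩
  have hne' : ∀ j, b j ≠ 0 → u₀ - a j ≠ 0 := fun j hj => sub_ne_zero.mpr (hne j hj)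
  set ψ : Fin k → ℂ → ℂ := fun j x => ((x - a j) / (u₀ - a j)) ^ b j with hψ
  have hsl : ∀ᶠ x in 𝓝 u₀, ∀ j, b j ≠ 0 → (x - a j) / (u₀ - a j) ∈ Complex.slitPlane := by
    refine eventually_all.mpr fun j => ?_
    rcases eq_or_ne (b j) 0 with h0 | h0
    · exact .of_forall fun x h => absurd h0 h
    · have hc : ContinuousAt (fun x => (x - a j) / (u₀ - a j)) u₀ :=
        (continuousAt_id.sub continuousAt_const).div_const _
      refine (hc.eventually_mem (Complex.isOpen_slitPlane.mem_nhds ?_)).mono fun x hx _ => hx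
      rw [div_self (hne' j h0)]
      exact Complex.one_mem_slitPlane
  obtain ⟨r, hr, hball⟩ := Metric.eventually_nhds_iff_ball.mp
    (hsl.and ((isOpen_regularSet f).mem_nhds hu))
  have hψ0 : ∀ x ∈ Metric.ball u₀ r, ∀ j, ψ j x ≠ 0 := by
    intro x hx j
    rcases eq_or_ne (b j) 0 with h0 | h0
    · simp [hψ, h0]
    · have := Complex.slitPlane_ne_zero ((hball x hx).1 j h0)
      simp only [hψ]
      rw [Ne, Complex.cpow_eq_zero_iff]
      exact fun h => this h.1
  have hψc : ∀ j, ContinuousOn (ψ j) (Metric.ball u₀ r) := by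
    intro j x hx
    refine ContinuousAt.continuousWithinAt ?_
    rcases eq_or_ne (b j) 0 with h0 | h0
    · simp only [hψ, h0, Complex.cpow_zero]
      exact continuousAt_const
    · exact ((continuousAt_id.sub continuousAt_const).div_const _).cpow continuousAt_const
        ((hball x hx).1 j h0)
  have hP0 : ∀ x ∈ Metric.ball u₀ r, ∏ j, ψ j x ≠ 0 := fun x hx =>
    Finset.prod_ne_zero_iff.mpr fun j _ => hψ0 x hx j
  set H : ℂ → ℂ := fun x => f x / ∏ j, ψ j x with hH
  have hHc : ContinuousOn H (Metric.ball u₀ r) := by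
    refine ContinuousOn.div (fun x hx => ?_) (continuousOn_finsetProd _ fun j _ => hψc j) hP0
    exact (hball x hx).2.1.continuousAt.continuousWithinAt
  let S : Set ℂ := Set.range fun n : Fin k → ℤ =>
    ∏ j, Complex.exp (b j * (Complex.log (u₀ - a j) + n j * (2 * Real.pi * Complex.I)))
  have hsub : H '' Metric.ball u₀ r ⊆ S := by
    rintro _ ⟨x, hx, rfl⟩
    obtain ⟨L, hL, hfx⟩ := hf.2 x (hball x hx).2
    have : ∀ j, ∃ n : ℤ, Complex.exp (b j * L j) = ψ j x *
        Complex.exp (b j * (Complex.log (u₀ - a j) + n * (2 * Real.pi * Complex.I))) := by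
      intro j
      rcases eq_or_ne (b j) 0 with h0 | h0
      · exact ⟨0, by simp [hψ, h0]⟩
      · have h1 := Complex.slitPlane_ne_zero ((hball x hx).1 j h0)
        have h2 : Complex.exp (L j) = Complex.exp
            (Complex.log ((x - a j) / (u₀ - a j)) + Complex.log (u₀ - a j)) := by
          rw [hL j h0, Complex.exp_add, Complex.exp_log h1, Complex.exp_log (hne' j h0),
            div_mul_cancel₀ _ (hne' j h0)]
        obtain ⟨n, hn⟩ := Complex.exp_eq_exp_iff_exists_int.mp h2
        refine ⟨n, ?_⟩
        simp only [hψ]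
        rw [Complex.cpow_def_of_ne_zero h1, ← Complex.exp_add, hn]
        ring_nf
    choose n hn using this
    refine ⟨n, ?_⟩
    simp only [hH]
    rw [hfx, Finset.prod_congr rfl fun j _ => hn j, Finset.prod_mul_distrib,
      mul_div_cancel_left₀ _ (hP0 x hx)]
  have hpre : IsPreconnected (H '' Metric.ball u₀ r) :=
    (convex_ball u₀ r).isPreconnected.image H hHc
  have hss := (Set.countable_range _ : S.Countable).isTotallyDisconnected _ hsub hpre
  filter_upwards [Metric.ball_mem_nhds u₀ hr] with x hx
  have h1 := hss (Set.mem_image_of_mem H hx)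
    (Set.mem_image_of_mem H (Metric.mem_ball_self hr))
  have h2 : ∏ j, ψ j u₀ = 1 := by
    refine Finset.prod_eq_one fun j _ => ?_
    rcases eq_or_ne (b j) 0 with h0 | h0
    · simp [hψ, h0]
    · simp [hψ, div_self (hne' j h0)]
  -- the constant value of `H` is `H u₀ = f u₀`
  simp only [hH] at h1
  rw [h2, div_one, div_eq_iff (hP0 x hx)] at h1
  exact h1

theorem isSymmMod_of_mem_quasiInvariants {m : ℕ} {f : ℂ → ℂ} {F : MvPolynomial (Fin 2) ℂ}
    (hF : F ∈ quasiInvariants m f) {u₀ : ℂ} (hu : u₀ ∈ regularSet f) :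
    IsSymmMod m u₀ fun p => f p.1 * MvPolynomial.eval ![p.1, p.2] F := by
  obtain ⟨g, hg, h⟩ := hF
  have hU : regularSet f ×ˢ regularSet f ∈ 𝓝 (u₀, u₀) :=
    prod_mem_nhds ((isOpen_regularSet f).mem_nhds hu) ((isOpen_regularSet f).mem_nhds hu)
  refine ⟨ContDiffAt.mul ?_ (contDiff_eval_pair F).contDiffAt, g, hg.contDiffAt hU, ?_⟩
  · exact ContDiffAt.comp (f := Prod.fst) (u₀, u₀) hu.1.contDiffAt contDiff_fst.contDiffAt
  · filter_upwards [hU] with p hp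
    exact h p.1 hp.1 p.2 hp.2

theorem neBot_nhdsWithin_offDiagonal (p : ℂ × ℂ) : (𝓝[{q : ℂ × ℂ | q.1 ≠ q.2}] p).NeBot := by
  rw [← mem_closure_iff_nhdsWithin_neBot]
  have h : Tendsto (fun t : ℂ => (p.1 + t, p.2)) (𝓝[≠] 0) (𝓝 p) := by
    have : Continuous fun t : ℂ => (p.1 + t, p.2) := by fun_prop
    simpa using (this.tendsto 0).mono_left nhdsWithin_le_nhds
  refine mem_closure_of_tendsto h ?_
  -- at most one small `t` leads to the diagonal
  rcases eq_or_ne p.1 p.2 with hp | hp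
  · filter_upwards [self_mem_nhdsWithin] with t ht
    simpa [hp] using ht
  · have : ∀ᶠ t : ℂ in 𝓝 0, p.1 + t ≠ p.2 :=
      (continuous_const.add continuous_id).continuousAt.eventually_ne (by simpa using hp)
    exact this.filter_mono nhdsWithin_le_nhds

/-- Quasi-invariance is local on the diagonal: the quotient by `(x - y) ^ (2 * m + 1)` extends
from the complement of the diagonal by taking limits. -/
theorem mem_quasiInvariants_of_isSymmMod {m : ℕ} {f : ℂ → ℂ} {F : MvPolynomial (Fin 2) ℂ}
    (h : ∀ u ∈ regularSet f,
      IsSymmMod m u fun p => f p.1 * MvPolynomial.eval ![p.1, p.2] F) :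
    F ∈ quasiInvariants m f := by
  set N : ℂ × ℂ → ℂ := fun p => f p.1 * MvPolynomial.eval ![p.1, p.2] F
    - f p.2 * MvPolynomial.eval ![p.2, p.1] F with hN
  have hloc : ∀ p ∈ regularSet f ×ˢ regularSet f, ∃ g : ℂ × ℂ → ℂ, ContDiffAt ℂ ∞ g p ∧
      ∀ᶠ q in 𝓝 p, N q = (q.1 - q.2) ^ (2 * m + 1) * g q := by
    rintro ⟨x, y⟩ ⟨hx, hy⟩
    rcases eq_or_ne x y with rfl | hxy
    · exact (h x hx).2
    · have hs : ContDiffAt ℂ ∞ (fun p : ℂ × ℂ => p.1 - p.2) (x, y) :=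
        (contDiff_fst.sub contDiff_snd).contDiffAt
      have h0 : x - y ≠ 0 := sub_ne_zero.mpr hxy
      refine ⟨fun q => N q / (q.1 - q.2) ^ (2 * m + 1), ContDiffAt.div ?_ (hs.pow _)
        (pow_ne_zero _ h0), ?_⟩
      · refine ContDiffAt.sub (ContDiffAt.mul ?_ (contDiff_eval_pair F).contDiffAt)
          (ContDiffAt.mul ?_ ?_)
        · exact ContDiffAt.comp (f := Prod.fst) (x, y) hx.1.contDiffAt contDiff_fst.contDiffAt
        · exact ContDiffAt.comp (f := Prod.snd) (x, y) hy.1.contDiffAt contDiff_snd.contDiffAt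
        · exact ((contDiff_eval_pair F).comp (contDiff_snd.prodMk contDiff_fst)).contDiffAt
      · filter_upwards [hs.continuousAt.eventually_ne h0] with q hq
        rw [mul_div_cancel₀ _ (pow_ne_zero _ hq)]
  set G : ℂ × ℂ → ℂ := fun p =>
    limUnder (𝓝[{q : ℂ × ℂ | q.1 ≠ q.2}] p) fun q => N q / (q.1 - q.2) ^ (2 * m + 1) with hG
  have hGg : ∀ p ∈ regularSet f ×ˢ regularSet f, ∀ g : ℂ × ℂ → ℂ, ContDiffAt ℂ ∞ g p →
      (∀ᶠ q in 𝓝 p, N q = (q.1 - q.2) ^ (2 * m + 1) * g q) → G =ᶠ[𝓝 p] g := by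
    intro p hp g hg hNg
    have hg1 : ContDiffAt ℂ 1 g p := hg.of_le (by exact_mod_cast le_top)
    filter_upwards [hg1.eventually (by simp), hNg.eventually_nhds] with q hq hNq
    have := neBot_nhdsWithin_offDiagonal q
    refine Tendsto.limUnder_eq ((hq.continuousAt.tendsto.mono_left nhdsWithin_le_nhds).congr' ?_)
    filter_upwards [hNq.filter_mono nhdsWithin_le_nhds, self_mem_nhdsWithin] with q' h1 h2
    rw [h1, mul_div_cancel_left₀ _ (pow_ne_zero _ (sub_ne_zero.mpr h2))]
  refine ⟨G, fun p hp => ?_, fun x hx y hy => ?_⟩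
  · obtain ⟨g, hg, hNg⟩ := hloc p hp
    exact (hg.congr_of_eventuallyEq (hGg p hp g hg hNg)).contDiffWithinAt
  · obtain ⟨g, hg, hNg⟩ := hloc (x, y) ⟨hx, hy⟩
    rw [(hGg (x, y) ⟨hx, hy⟩ g hg hNg).eq_of_nhds]
    exact hNg.self_of_nhds

/-- A family of polynomials of bounded degree that vanishes to order `M` at `w = 0` after
evaluation at each point of an infinite set has coefficients vanishing to order `M`, by Lagrange
interpolation. -/
theorem coeff_eq_pow_mul_of_eval {p : ℂ → ℂ[X]} {n M : ℕ} (hp : ∀ w, (p w).degree < n) {S : Set ℂ}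
    (hS : S.Infinite) (h : ∀ u ∈ S, ∃ k : ℂ → ℂ, AnalyticAt ℂ k 0 ∧
      ∀ᶠ w in 𝓝 (0 : ℂ), (p w).eval u = w ^ M * k w) (i : ℕ) :
    ∃ k : ℂ → ℂ, AnalyticAt ℂ k 0 ∧ ∀ᶠ w in 𝓝 (0 : ℂ), (p w).coeff i = w ^ M * k w := by
  obtain ⟨s, hsS, hs⟩ := hS.exists_subset_card_eq n
  choose! k hk hkw using h
  refine ⟨fun w => ∑ u ∈ s, k u w * (Lagrange.basis s id u).coeff i, ?_, ?_⟩
  · exact Finset.analyticAt_fun_sum _ fun u hu => (hk u (hsS hu)).mul analyticAt_const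
  · have : ∀ᶠ w in 𝓝 (0 : ℂ), ∀ u ∈ s, (p w).eval u = w ^ M * k u w :=
      (Finset.eventually_all s).mpr fun u hu => hkw u (hsS hu)
    filter_upwards [this] with w hw
    rw [Lagrange.eq_interpolate (s := s) (v := id) (f := p w) Function.injective_id.injOn
      (by rw [hs]; exact hp w), Lagrange.interpolate_apply, finsetSum_coeff, Finset.mul_sum]
    refine Finset.sum_congr rfl fun u hu => ?_
    rw [coeff_C_mul, id, hw u hu]
    ring

/-- The substitution `x = a + u * (1 + w)`, `y = a + u * (1 - w)`, with values in the polynomials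
in `u` over `ℂ[w]`. The coefficient of `u ^ n` collects the part of degree `n` at `(a, a)`. -/
noncomputable def polarExpansion (a : ℂ) : MvPolynomial (Fin 2) ℂ →ₐ[ℂ] ℂ[X][X] :=
  MvPolynomial.aeval ![C (C a) + X * C (1 + X), C (C a) + X * C (1 - X)]

theorem natDegree_coeff_polarExpansion_le (a : ℂ) (F : MvPolynomial (Fin 2) ℂ) (n : ℕ) :
    ((polarExpansion a F).coeff n).natDegree ≤ n := by
  have aux : ∀ (p : ℂ[X][X]) (l : ℂ[X]), l.natDegree ≤ 1 → (∀ n, (p.coeff n).natDegree ≤ n) →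
      ∀ n, ((p * (C (C a) + X * C l)).coeff n).natDegree ≤ n := by
    intro p l hl hp n
    rw [mul_add, ← mul_assoc, coeff_add, coeff_mul_C, coeff_mul_C]
    refine natDegree_add_le_of_degree_le ((natDegree_mul_C_le _ _).trans (hp n)) ?_
    rcases n with _ | n
    · simp
    · rw [coeff_mul_X]
      exact natDegree_mul_le.trans (add_le_add (hp n) hl)
  induction F using MvPolynomial.induction_on generalizing n with
  | C c =>
    rw [polarExpansion, MvPolynomial.aeval_C, Polynomial.algebraMap_apply, Polynomial.algebraMap_apply, coeff_C]
    split_ifs <;> simp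
  | add P Q hP hQ =>
    rw [map_add, coeff_add]
    exact natDegree_add_le_of_degree_le (hP n) (hQ n)
  | mul_X P i hP =>
    rw [map_mul, polarExpansion, MvPolynomial.aeval_X]
    fin_cases i
    · exact aux _ _ (by compute_degree) hP n
    · exact aux _ _ (by compute_degree) hP n

theorem eval_map_polarExpansion (a w u : ℂ) (F : MvPolynomial (Fin 2) ℂ) :
    ((polarExpansion a F).map (evalRingHom w)).eval u
      = MvPolynomial.eval ![a + u * (1 + w), a + u * (1 - w)] F := by
  induction F using MvPolynomial.induction_on with
  | C c => simp [polarExpansion, Polynomial.algebraMap_apply]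
  | add P Q hP hQ => simp [hP, hQ]
  | mul_X P i hP =>
    rw [map_mul, Polynomial.map_mul, eval_mul, hP, map_mul]
    fin_cases i <;> simp [polarExpansion]

theorem map_polarExpansion_zero (a : ℂ) (F : MvPolynomial (Fin 2) ℂ) :
    (polarExpansion a F).map (evalRingHom 0) = (diag F).comp (X + C a) := by
  induction F using MvPolynomial.induction_on with
  | C c => simp [polarExpansion, Polynomial.algebraMap_apply]
  | add P Q hP hQ => simp [hP, hQ]
  | mul_X P i hP =>
    rw [map_mul, Polynomial.map_mul, hP, map_mul, mul_comp]
    fin_cases i <;> simp [polarExpansion, add_comm]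

/-- For `f = (x - a) ^ b`, each homogeneous component at `(a, a)` of a quasi-invariant is
quasi-invariant, hence has degree at least `d_m(b)` if it is nonzero. -/
theorem IsSymmMod.X_sub_C_pow_dvd_diag {m : ℕ} {a b c u₀ : ℂ} {F : MvPolynomial (Fin 2) ℂ}
    (hc : c ≠ 0) (hu : u₀ ≠ a)
    (h : IsSymmMod m u₀ fun p => c * ((p.1 - a) / (u₀ - a)) ^ b
      * MvPolynomial.eval ![p.1, p.2] F) :
    (X - C a) ^ dExp m b ∣ diag F := by
  obtain ⟨-, g, hg, h⟩ := h
  have hu' : u₀ - a ≠ 0 := sub_ne_zero.mpr hu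
  set T := polarExpansion a F with hT
  set p : ℂ → ℂ[X] := fun w => C ((1 + w) ^ b) * T.map (evalRingHom w)
    - C ((1 - w) ^ b) * T.map (evalRingHom (-w)) with hp
  have hdeg : ∀ w, (p w).degree < (T.natDegree + 1 : ℕ) := by
    intro w
    refine degree_lt_iff_coeff_zero _ _ |>.mpr fun n hn => ?_
    simp only [hp, coeff_sub, coeff_C_mul, coeff_map,
      coeff_eq_zero_of_natDegree_lt (Nat.lt_of_succ_le hn), map_zero, mul_zero, sub_zero]
  have hg1 : ContDiffAt ℂ 1 g (u₀, u₀) := hg.of_le (by exact_mod_cast le_top)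
  -- all but finitely many points `s` near `u₀ - a`
  have hev : ∀ᶠ s in 𝓝 (u₀ - a), s ≠ 0 ∧ 0 < (s / (u₀ - a)).re ∧
      ContDiffAt ℂ 1 g (a + s, a + s) ∧ ∀ᶠ q in 𝓝 (a + s, a + s),
        (c * ((q.1 - a) / (u₀ - a)) ^ b * MvPolynomial.eval ![q.1, q.2] F
          - c * ((q.swap.1 - a) / (u₀ - a)) ^ b * MvPolynomial.eval ![q.swap.1, q.swap.2] F)
          = (q.1 - q.2) ^ (2 * m + 1) * g q := by
    have ht : Tendsto (fun s : ℂ => (a + s, a + s)) (𝓝 (u₀ - a)) (𝓝 (u₀, u₀)) := by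
      have : Continuous fun s : ℂ => (a + s, a + s) := by fun_prop
      simpa using this.tendsto (u₀ - a)
    refine (eventually_ne_nhds hu').and (Filter.Eventually.and ?_ (Filter.Eventually.and ?_ ?_))
    · exact eventually_re_pos (continuousAt_id.div_const _) (div_self hu')
    · exact ht.eventually (hg1.eventually (by simp))
    · exact ht.eventually h.eventually_nhds
  have hS : {s : ℂ | s ≠ 0 ∧ 0 < (s / (u₀ - a)).re ∧
      ContDiffAt ℂ 1 g (a + s, a + s) ∧ ∀ᶠ q in 𝓝 (a + s, a + s),
        (c * ((q.1 - a) / (u₀ - a)) ^ b * MvPolynomial.eval ![q.1, q.2] F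
          - c * ((q.swap.1 - a) / (u₀ - a)) ^ b * MvPolynomial.eval ![q.swap.1, q.swap.2] F)
          = (q.1 - q.2) ^ (2 * m + 1) * g q}.Infinite := infinite_of_mem_nhds _ hev
  have key := coeff_eq_pow_mul_of_eval (M := 2 * m + 1) hdeg hS ?_
  · have hdvd : X ^ dExp m b ∣ T := by
      rw [X_pow_dvd_iff]
      intro n hn
      by_contra h0
      have hE : IsEvenMod m b (T.coeff n) := by
        obtain ⟨k, hk, h⟩ := key n
        refine ⟨k, hk, h.mono fun w hw => ?_⟩
        simpa only [hp, coeff_sub, coeff_C_mul, coeff_map, coe_evalRingHom] using hw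
      have h1 := hE.dExp_le_natDegree h0
      have h2 : (T.coeff n).natDegree ≤ n := natDegree_coeff_polarExpansion_le a F n
      omega
    have h1 := Polynomial.map_dvd (evalRingHom 0) hdvd
    rw [hT, map_polarExpansion_zero, Polynomial.map_pow, map_X] at h1
    obtain ⟨r, hr⟩ := h1
    refine ⟨r.comp (X - C a), ?_⟩
    have := congrArg (fun p => p.comp (X - C a)) hr
    simpa [comp_assoc, mul_comp] using this
  · rintro s ⟨hs0, hsre, hgs, hs⟩
    set k₀ : ℂ → ℂ := fun w => g (a + s * (1 + w), a + s * (1 - w)) with hk₀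
    have hk : AnalyticAt ℂ k₀ 0 := by
      have hcd : ContDiffAt ℂ 1 k₀ 0 := by
        refine ContDiffAt.comp (f := fun w : ℂ => (a + s * (1 + w), a + s * (1 - w))) 0
          (by simpa using hgs) (ContDiff.contDiffAt (by fun_prop))
      rw [Complex.analyticAt_iff_eventually_differentiableAt]
      exact (hcd.eventually (by simp)).mono fun w hw => hw.differentiableAt (by simp)
    have hcs : c * (s / (u₀ - a)) ^ b ≠ 0 := by
      refine mul_ne_zero hc ?_
      rw [Ne, Complex.cpow_eq_zero_iff]
      exact fun h => div_ne_zero hs0 hu' h.1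
    refine ⟨fun w => (c * (s / (u₀ - a)) ^ b)⁻¹ * (2 * s) ^ (2 * m + 1) * k₀ w,
      analyticAt_const.mul hk, ?_⟩
    have ht : Tendsto (fun w : ℂ => (a + s * (1 + w), a + s * (1 - w))) (𝓝 0)
        (𝓝 (a + s, a + s)) := by
      have : Continuous fun w : ℂ => (a + s * (1 + w), a + s * (1 - w)) := by fun_prop
      simpa using this.tendsto 0
    have r1 : ∀ᶠ w : ℂ in 𝓝 0, 0 < (1 + w).re :=
      eventually_re_pos (continuousAt_const.add continuousAt_id) (by simp)
    have r2 : ∀ᶠ w : ℂ in 𝓝 0, 0 < (1 - w).re :=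
      eventually_re_pos (continuousAt_const.sub continuousAt_id) (by simp)
    filter_upwards [ht.eventually hs, r1, r2] with w hw h1 h2
    simp only [Prod.swap_prod_mk] at hw
    rw [show (a + s * (1 + w) - a) / (u₀ - a) = s / (u₀ - a) * (1 + w) by ring,
      show (a + s * (1 - w) - a) / (u₀ - a) = s / (u₀ - a) * (1 - w) by ring,
      Complex.mul_cpow_of_re_pos hsre h1, Complex.mul_cpow_of_re_pos hsre h2,
      show a + s * (1 + w) - (a + s * (1 - w)) = w * (2 * s) by ring, mul_pow] at hw
    have e2 := eval_map_polarExpansion a (-w) s F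
    rw [sub_neg_eq_add, ← sub_eq_add_neg] at e2
    simp only [hp, eval_sub, eval_mul, eval_C]
    rw [hT, eval_map_polarExpansion, e2]
    refine mul_left_cancel₀ hcs ?_
    have e3 : c * (s / (u₀ - a)) ^ b * (w ^ (2 * m + 1) *
        ((c * (s / (u₀ - a)) ^ b)⁻¹ * (2 * s) ^ (2 * m + 1) * k₀ w))
        = w ^ (2 * m + 1) * (2 * s) ^ (2 * m + 1) * k₀ w := by
      have := mul_inv_cancel₀ hcs
      linear_combination (w ^ (2 * m + 1) * (2 * s) ^ (2 * m + 1) * k₀ w) * this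
    rw [e3]
    simp only [hk₀]
    rw [← hw]
    ring

/-- The minimal quasi-invariant, the product of the minimal quasi-invariants of the factors. -/
theorem IsPowerProduct.exists_mem_quasiInvariants {k : ℕ} {a b : Fin k → ℂ} {f : ℂ → ℂ}
    (hf : IsPowerProduct a b f) (m : ℕ) :
    ∃ P ∈ quasiInvariants m f, P.totalDegree ≤ dTotal m b ∧
      diag P = ∏ j, (X - C (a j)) ^ dExp m (b j) := by
  choose P hPd hP hPs using fun j => exists_isSymmMod_factor m (a j) (b j)
  refine ⟨∏ j, P j, mem_quasiInvariants_of_isSymmMod fun u hu => ?_, ?_, ?_⟩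
  · obtain ⟨hne, hfu⟩ := hf.eventually_eq hu
    refine ((isSymmMod_const m u (f u)).mul (IsSymmMod.prod Finset.univ
      fun j _ => hPs j u (hne j))).congr ?_
    have : Tendsto (fun p : ℂ × ℂ => p.1) (𝓝 (u, u)) (𝓝 u) := continuous_fst.tendsto (u, u)
    filter_upwards [this.eventually hfu] with p hp
    rw [hp, Finset.prod_mul_distrib, map_prod, mul_assoc]
  · exact (MvPolynomial.totalDegree_finsetProd _ _).trans (Finset.sum_le_sum fun j _ => hPd j)
  · rw [map_prod, Finset.prod_congr rfl fun j _ => hP j]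

/-- Multiplying by the minimal quasi-invariants of the inverses of the other factors reduces this
to the case of a single factor. -/
theorem IsPowerProduct.prod_dvd_diag {k : ℕ} {a b : Fin k → ℂ} (ha : Function.Injective a)
    {f : ℂ → ℂ} (hf : IsPowerProduct a b f) {m : ℕ} {F : MvPolynomial (Fin 2) ℂ}
    (hF : F ∈ quasiInvariants m f) : ∏ j, (X - C (a j)) ^ dExp m (b j) ∣ diag F := by
  classical
  refine Finset.prod_dvd_of_coprime (fun i _ j _ hij => ?_) fun j _ => ?_
  · exact (isCoprime_X_sub_C_of_isUnit_sub
      (isUnit_iff_ne_zero.mpr (sub_ne_zero.mpr (ha.ne hij)))).pow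
  obtain ⟨u, hu, hua⟩ : ∃ u ∈ regularSet f, u ∉ Set.range a := by
    obtain ⟨z, hz⟩ := hf.1
    exact ((infinite_of_mem_nhds z ((isOpen_regularSet f).mem_nhds hz)).sdiff
      (Set.finite_range a)).nonempty
  have hne : ∀ i, u ≠ a i := fun i h => hua ⟨i, h.symm⟩
  choose P _ hP hPs using fun i => exists_isSymmMod_factor m (a i) (-b i)
  have h1 := (isSymmMod_of_mem_quasiInvariants hF hu).mul (IsSymmMod.prod (Finset.univ.erase j)
    fun i _ => hPs i u fun _ => hne i)
  have h2 : IsSymmMod m u fun p => f u * ((p.1 - a j) / (u - a j)) ^ b j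
      * MvPolynomial.eval ![p.1, p.2] (F * ∏ i ∈ Finset.univ.erase j, P i) := by
    refine h1.congr ?_
    have ht : Tendsto (fun p : ℂ × ℂ => p.1) (𝓝 (u, u)) (𝓝 u) := continuous_fst.tendsto (u, u)
    have hn : ∀ᶠ x in 𝓝 u, ∀ i, x ≠ a i :=
      eventually_all.mpr fun i => eventually_ne_nhds (hne i)
    filter_upwards [ht.eventually (hf.eventually_eq hu).2, ht.eventually hn] with p hp hpn
    rw [hp, Finset.prod_mul_distrib, map_mul, map_prod,
      ← Finset.mul_prod_erase Finset.univ _ (Finset.mem_univ j)]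
    have h3 : (∏ i ∈ Finset.univ.erase j, ((p.1 - a i) / (u - a i)) ^ b i)
        * ∏ i ∈ Finset.univ.erase j, ((p.1 - a i) / (u - a i)) ^ (-b i) = 1 := by
      rw [← Finset.prod_mul_distrib]
      refine Finset.prod_eq_one fun i _ => ?_
      rw [Complex.cpow_neg, mul_inv_cancel₀]
      rw [Ne, Complex.cpow_eq_zero_iff]
      exact fun h => div_ne_zero (sub_ne_zero.mpr (hpn i)) (sub_ne_zero.mpr (hne i)) h.1
    linear_combination (f u * ((p.1 - a j) / (u - a j)) ^ b j
      * MvPolynomial.eval ![p.1, p.2] F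
      * ∏ i ∈ Finset.univ.erase j, MvPolynomial.eval ![p.1, p.2] (P i)) * h3
  have h4 := h2.X_sub_C_pow_dvd_diag hu.2 (hne j)
  rw [map_mul, map_prod] at h4
  refine IsCoprime.dvd_of_dvd_mul_right (IsCoprime.prod_right fun i hi => ?_) h4
  rw [hP i]
  exact (isCoprime_X_sub_C_of_isUnit_sub (isUnit_iff_ne_zero.mpr
    (sub_ne_zero.mpr (ha.ne (Finset.ne_of_mem_erase hi).symm)))).pow
end LocalForm

/-! ### Polynomials and the diagonal -/

section Diagonal

open MvPolynomial

theorem diag_X (i : Fin 2) : diag (X i) = Polynomial.X := by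
  fin_cases i <;> simp [diag]

theorem diag_rename_swap (F : MvPolynomial (Fin 2) ℂ) :
    diag (rename (Equiv.swap (0 : Fin 2) 1) F) = diag F := by
  rw [diag, aeval_rename]
  congr 2
  funext i
  fin_cases i <;> simp

theorem X_sub_X_ne_zero : (X 0 - X 1 : MvPolynomial (Fin 2) ℂ) ≠ 0 :=
  sub_ne_zero.mpr fun h => absurd (X_injective h) (by decide)

theorem isHomogeneous_X_sub_X_pow (r : ℕ) :
    ((X 0 - X 1 : MvPolynomial (Fin 2) ℂ) ^ r).IsHomogeneous r := by
  simpa using ((isHomogeneous_X ℂ (0 : Fin 2)).sub (isHomogeneous_X ℂ (1 : Fin 2))).pow r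

theorem X_sub_X_dvd_of_diag_eq_zero {F : MvPolynomial (Fin 2) ℂ} (h : diag F = 0) :
    X 0 - X 1 ∣ F := by
  have key : ∀ F : MvPolynomial (Fin 2) ℂ,
      X 0 - X 1 ∣ F - Polynomial.aeval (X 1 : MvPolynomial (Fin 2) ℂ) (diag F) := by
    intro F
    induction F using MvPolynomial.induction_on with
    | C c => simp [diag, MvPolynomial.algebraMap_eq]
    | add P Q hP hQ =>
      have := hP.add hQ
      rwa [map_add, map_add, add_sub_add_comm]
    | mul_X P i hP =>
      rw [map_mul, map_mul, diag_X, Polynomial.aeval_X]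
      have h1 : X 0 - X 1 ∣ (X i - X 1 : MvPolynomial (Fin 2) ℂ) := by
        fin_cases i <;> simp
      have := (hP.mul_right (X i)).add
        (h1.mul_left (Polynomial.aeval (X 1 : MvPolynomial (Fin 2) ℂ) (diag P)))
      convert this using 1
      ring
  simpa [h] using key F

theorem mem_SymPoly_iff {F : MvPolynomial (Fin 2) ℂ} :
    F ∈ SymPoly ↔ rename (Equiv.swap (0 : Fin 2) 1) F = F := by
  constructor
  · intro h
    exact h _
  · intro h e
    have he : e = 1 ∨ e = Equiv.swap 0 1 := by
      revert e; decide
    rcases he with rfl | rfl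
    · simp
    · exact h

/-- A symmetric polynomial vanishing on the diagonal is divisible by `(x - y) ^ 2` in the ring of
symmetric polynomials. -/
theorem exists_eq_X_sub_X_sq_mul {s : SymPoly} (h : diag (s : MvPolynomial (Fin 2) ℂ) = 0) :
    ∃ t : SymPoly, (s : MvPolynomial (Fin 2) ℂ) = (X 0 - X 1) ^ 2 * (t : MvPolynomial (Fin 2) ℂ) := by
  obtain ⟨t, ht⟩ := X_sub_X_dvd_of_diag_eq_zero h
  have hs := mem_SymPoly_iff.mp s.2
  have ht' : rename (Equiv.swap (0 : Fin 2) 1) t = -t := by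
    rw [ht, map_mul, map_sub, rename_X, rename_X, Equiv.swap_apply_left,
      Equiv.swap_apply_right] at hs
    refine mul_left_cancel₀ X_sub_X_ne_zero ?_
    linear_combination -hs
  have hd : diag t = 0 := by
    have h2 := diag_rename_swap t
    rw [ht', map_neg] at h2
    exact self_eq_neg.mp h2.symm
  obtain ⟨t', rfl⟩ := X_sub_X_dvd_of_diag_eq_zero hd
  refine ⟨⟨t', mem_SymPoly_iff.mpr ?_⟩, by rw [ht]; ring⟩
  rw [map_mul, map_sub, rename_X, rename_X, Equiv.swap_apply_left,
    Equiv.swap_apply_right] at ht'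
  refine mul_left_cancel₀ X_sub_X_ne_zero ?_
  linear_combination -ht'

/-- The symmetric polynomial `h ((x + y) / 2)`, whose restriction to the diagonal is `h`. -/
noncomputable def symLift : Polynomial ℂ →ₐ[ℂ] MvPolynomial (Fin 2) ℂ :=
  Polynomial.aeval (C (1 / 2) * (X 0 + X 1))

theorem diag_symLift (h : Polynomial ℂ) : diag (symLift h) = h := by
  have h2 : (Polynomial.C (1 / 2 : ℂ) * (Polynomial.X + Polynomial.X)) = Polynomial.X := by
    rw [← two_mul, ← mul_assoc, show (2 : Polynomial ℂ) = Polynomial.C 2 from rfl,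
      ← Polynomial.C_mul]
    simp
  have : diag.comp symLift = AlgHom.id ℂ (Polynomial ℂ) := by
    ext
    simp only [AlgHom.comp_apply, symLift, Polynomial.aeval_X, map_mul, map_add, diag_X,
      AlgHom.id_apply]
    rw [← MvPolynomial.algebraMap_eq, AlgHom.commutes, Polynomial.algebraMap_eq, h2]
  exact DFunLike.congr_fun this h

theorem symLift_mem (h : Polynomial ℂ) : symLift h ∈ SymPoly := by
  rw [mem_SymPoly_iff]
  have : (rename (Equiv.swap (0 : Fin 2) 1)).comp symLift = symLift := by
    ext
    simp only [AlgHom.comp_apply, symLift, Polynomial.aeval_X, map_mul, map_add, rename_X,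
      rename_C, Equiv.swap_apply_left, Equiv.swap_apply_right, add_comm]
  exact DFunLike.congr_fun this h

theorem symLift_eq_sum {h : Polynomial ℂ} {n : ℕ} (hn : h.natDegree ≤ n) :
    symLift h = ∑ i ∈ Finset.range (n + 1), C (h.coeff i) * symLift Polynomial.X ^ i := by
  conv_lhs => rw [h.as_sum_range_C_mul_X_pow' (Nat.lt_succ_of_le hn)]
  rw [map_sum]
  refine Finset.sum_congr rfl fun i _ => ?_
  rw [map_mul, map_pow, ← Polynomial.algebraMap_eq, AlgHom.commutes, MvPolynomial.algebraMap_eq]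

theorem isHomogeneous_symLift_X_pow (n : ℕ) : (symLift Polynomial.X ^ n).IsHomogeneous n := by
  have h1 : (symLift Polynomial.X).IsHomogeneous 1 := by
    rw [symLift, Polynomial.aeval_X]
    simpa using (isHomogeneous_C (Fin 2) (1 / 2 : ℂ)).mul
      ((isHomogeneous_X ℂ (0 : Fin 2)).add (isHomogeneous_X ℂ (1 : Fin 2)))
  simpa using h1.pow n

theorem totalDegree_symLift_le (h : Polynomial ℂ) : (symLift h).totalDegree ≤ h.natDegree := by
  rw [symLift_eq_sum le_rfl]
  refine (totalDegree_finsetSum _ _).trans (Finset.sup_le fun i hi => ?_)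
  refine (totalDegree_mul _ _).trans ?_
  rw [totalDegree_C, zero_add]
  exact (isHomogeneous_symLift_X_pow i).totalDegree_le.trans
    (Nat.lt_succ_iff.mp (Finset.mem_range.mp hi))

theorem natDegree_diag_le (F : MvPolynomial (Fin 2) ℂ) :
    (diag F).natDegree ≤ F.totalDegree := by
  simpa using aeval_natDegree_le F le_rfl ![Polynomial.X, Polynomial.X] (n := 1)
    (fun i => by fin_cases i <;> simp)

theorem eval_diag (F : MvPolynomial (Fin 2) ℂ) (u : ℂ) : (diag F).eval u = eval ![u, u] F := by
  induction F using MvPolynomial.induction_on with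
  | C c => simp [diag]
  | add P Q hP hQ => simp [hP, hQ]
  | mul_X P i hP =>
    rw [map_mul, Polynomial.eval_mul, hP, map_mul, diag_X]
    fin_cases i <;> simp

end Diagonal

/-! ### The filtration of the quasi-invariants by `m` -/

section Filtration

open MvPolynomial Filter Topology

/-- The minimal quasi-invariant for `m = 0` has degree zero, and so is the constant `1`. -/
theorem one_mem_quasiInvariants_zero {k : ℕ} {a b : Fin k → ℂ} {f : ℂ → ℂ}
    (hf : IsPowerProduct a b f) : 1 ∈ quasiInvariants 0 f := by
  obtain ⟨P, hP, hd, hdiag⟩ := hf.exists_mem_quasiInvariants 0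
  have h0 : ∀ z, dExp 0 z = 0 := fun z => Nat.le_zero.mp (dExp_le 0 z)
  simp only [dTotal, h0, Finset.sum_const_zero, pow_zero, Finset.prod_const_one] at hd hdiag
  rw [totalDegree_eq_zero_iff_eq_C.mp (Nat.le_zero.mp hd)] at hP hdiag
  rw [diag, aeval_C, Polynomial.algebraMap_eq] at hdiag
  rwa [Polynomial.C_injective (hdiag.trans Polynomial.C_1.symm), C_1] at hP

/-- For `m = 0` there is no condition, since a difference of values of a smooth function is
divisible by `x - y`. -/
theorem quasiInvariants_zero {k : ℕ} {a b : Fin k → ℂ} {f : ℂ → ℂ}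
    (hf : IsPowerProduct a b f) : quasiInvariants 0 f = ⊤ := by
  refine eq_top_iff.mpr fun F _ => mem_quasiInvariants_of_isSymmMod fun u hu => ?_
  have h1 := isSymmMod_of_mem_quasiInvariants (one_mem_quasiInvariants_zero hf) hu
  have h2 : IsSymmMod 0 u fun p => eval ![p.1, p.2] F := by
    have hd : diag (F - rename (Equiv.swap (0 : Fin 2) 1) F) = 0 := by
      rw [map_sub, diag_rename_swap, sub_self]
    obtain ⟨G, hG⟩ := X_sub_X_dvd_of_diag_eq_zero hd
    refine ⟨(contDiff_eval_pair F).contDiffAt, fun p => eval ![p.1, p.2] G,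
      (contDiff_eval_pair G).contDiffAt, .of_forall fun p => ?_⟩
    have h3 := congrArg (eval ![p.1, p.2]) hG
    have e : (![p.1, p.2] : Fin 2 → ℂ) ∘ Equiv.swap (0 : Fin 2) 1 = ![p.2, p.1] := by
      funext i
      fin_cases i <;> simp
    rw [map_sub, eval_rename, e] at h3
    simpa using h3
  refine (h1.mul h2).congr (.of_forall fun p => ?_)
  simp

theorem quasiInvariants_succ_le (m : ℕ) (f : ℂ → ℂ) :
    quasiInvariants (m + 1) f ≤ quasiInvariants m f := by
  rintro F ⟨g, hg, h⟩
  refine ⟨fun p => (p.1 - p.2) ^ 2 * g p,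
    (((contDiff_fst.sub contDiff_snd).pow 2).contDiffOn).mul hg, fun x hx y hy => ?_⟩
  rw [h x hx y hy]
  ring

theorem X_sub_X_sq_mul_mem {m : ℕ} {f : ℂ → ℂ} {F : MvPolynomial (Fin 2) ℂ} :
    (X 0 - X 1) ^ 2 * F ∈ quasiInvariants (m + 1) f ↔ F ∈ quasiInvariants m f := by
  constructor
  · rintro ⟨g, hg, h⟩
    refine ⟨g, hg, fun x hx y hy => ?_⟩
    rcases eq_or_ne x y with rfl | hxy
    · simp
    · have := h x hx y hy
      simp only [map_mul, map_pow, map_sub, eval_X, Matrix.cons_val_zero,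
        Matrix.cons_val_one] at this
      refine mul_left_cancel₀ (pow_ne_zero 2 (sub_ne_zero.mpr hxy)) ?_
      linear_combination this
  · rintro ⟨g, hg, h⟩
    refine ⟨g, hg, fun x hx y hy => ?_⟩
    have := h x hx y hy
    simp only [map_mul, map_pow, map_sub, eval_X, Matrix.cons_val_zero, Matrix.cons_val_one]
    linear_combination (x - y) ^ 2 * this

/-- The elements of `Q_{m+1}(f)` vanishing on the diagonal are the elements of
`(x - y) ^ 2 Q_m(f)`. -/
theorem exists_eq_of_diag_eq_zero {k : ℕ} {a b : Fin k → ℂ} {f : ℂ → ℂ}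
    (hf : IsPowerProduct a b f) {m : ℕ} {F : MvPolynomial (Fin 2) ℂ}
    (hF : F ∈ quasiInvariants (m + 1) f) (hd : diag F = 0) :
    ∃ G ∈ quasiInvariants m f, F = (X 0 - X 1) ^ 2 * G := by
  obtain ⟨H, rfl⟩ := X_sub_X_dvd_of_diag_eq_zero hd
  have hH : diag H = 0 := by
    obtain ⟨g, hg, h⟩ := hF
    obtain ⟨z, hz⟩ := hf.1
    refine Polynomial.eq_zero_of_infinite_isRoot _ ((infinite_of_mem_nhds z
      ((isOpen_regularSet f).mem_nhds hz)).mono fun u hu => ?_)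
    have hUo := isOpen_regularSet f
    -- divide by `x - y` and let `y` tend to `x = u`
    have ht : Tendsto (fun y : ℂ => (u, y)) (𝓝[≠] u) (𝓝 (u, u)) := by
      have : Continuous fun y : ℂ => (u, y) := by fun_prop
      exact (this.tendsto u).mono_left nhdsWithin_le_nhds
    have hgc : ContinuousAt g (u, u) :=
      (hg.contDiffAt (prod_mem_nhds (hUo.mem_nhds hu) (hUo.mem_nhds hu))).continuousAt
    have hc : ∀ G : MvPolynomial (Fin 2) ℂ, Continuous fun p : ℂ × ℂ => eval ![p.1, p.2] G :=
      fun G => (contDiff_eval_pair G).continuous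
    have t1 : Tendsto (fun y => f u * eval ![u, y] H + f y * eval ![y, u] H) (𝓝[≠] u)
        (𝓝 (f u * eval ![u, u] H + f u * eval ![u, u] H)) := by
      have c1 : ContinuousAt (fun y => f u * eval ![u, y] H + f y * eval ![y, u] H) u := by
        refine (continuousAt_const.mul ?_).add (hu.1.continuousAt.mul ?_)
        · exact ((hc H).comp (f := fun y : ℂ => (u, y)) (by fun_prop)).continuousAt
        · exact ((hc H).comp (f := fun y : ℂ => (y, u)) (by fun_prop)).continuousAt
      exact c1.tendsto.mono_left nhdsWithin_le_nhds
    have t2 : Tendsto (fun y => (u - y) ^ (2 * m + 2) * g (u, y)) (𝓝[≠] u)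
        (𝓝 ((u - u) ^ (2 * m + 2) * g (u, u))) := by
      have c2 : ContinuousAt (fun y : ℂ => (u - y) ^ (2 * m + 2)) u := by fun_prop
      exact (c2.tendsto.mono_left nhdsWithin_le_nhds).mul (hgc.tendsto.comp ht)
    have e : (fun y => f u * eval ![u, y] H + f y * eval ![y, u] H)
        =ᶠ[𝓝[≠] u] fun y => (u - y) ^ (2 * m + 2) * g (u, y) := by
      filter_upwards [(hUo.mem_nhds hu : regularSet f ∈ 𝓝 u) |> mem_nhdsWithin_of_mem_nhds,
        self_mem_nhdsWithin] with y hy hyu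
      have := h u hu y hy
      simp only [map_mul, map_sub, eval_X, Matrix.cons_val_zero, Matrix.cons_val_one] at this
      refine mul_left_cancel₀ (sub_ne_zero.mpr (Ne.symm hyu)) ?_
      linear_combination this
    have h3 := tendsto_nhds_unique t1 (t2.congr' e.symm)
    rw [sub_self, zero_pow (by omega), zero_mul, ← two_mul] at h3
    change (diag H).eval u = 0
    rw [eval_diag]
    simpa [hu.2] using h3
  obtain ⟨G, rfl⟩ := X_sub_X_dvd_of_diag_eq_zero hH
  rw [← mul_assoc, ← sq] at hF ⊢
  exact ⟨G, X_sub_X_sq_mul_mem.mp hF, rfl⟩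

end Filtration

/-! ### Generators and relations -/

section Relations

open MvPolynomial

/-- The invariant `(x - y) ^ 2`. -/
noncomputable def discSym : SymPoly :=
  ⟨(X 0 - X 1) ^ 2, mem_SymPoly_iff.mpr (by
    rw [map_pow, map_sub, rename_X, rename_X, Equiv.swap_apply_left, Equiv.swap_apply_right]
    ring)⟩

theorem discSym_ne_zero : discSym ≠ 0 := fun h =>
  pow_ne_zero 2 X_sub_X_ne_zero (congrArg Subtype.val h)

theorem discSym_smul (F : MvPolynomial (Fin 2) ℂ) : discSym • F = (X 0 - X 1) ^ 2 * F := rfl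

theorem exists_eq_discSym_mul {s : SymPoly} (h : diag (s : MvPolynomial (Fin 2) ℂ) = 0) :
    ∃ t : SymPoly, s = t * discSym := by
  obtain ⟨t, ht⟩ := exists_eq_X_sub_X_sq_mul h
  refine ⟨t, Subtype.ext ?_⟩
  rw [ht, mul_comm]
  rfl

theorem generators_succ_castSucc (m : ℕ) (P : ℕ → MvPolynomial (Fin 2) ℂ) (i : Fin m) :
    generators (m + 1) P (Sum.inl i.castSucc) = discSym • generators m P (Sum.inl i) := by
  have : 2 * (m + 1 - ((i : ℕ) + 1)) = 2 + 2 * (m - ((i : ℕ) + 1)) := by omega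
  simp only [generators, Sum.elim_inl, Fin.val_castSucc, this, pow_add, discSym_smul, mul_assoc]

theorem generators_succ_last (m : ℕ) (P : ℕ → MvPolynomial (Fin 2) ℂ) :
    generators (m + 1) P (Sum.inl (Fin.last m)) = P (m + 1) := by
  simp [generators]

theorem generators_succ_inr (m : ℕ) (P : ℕ → MvPolynomial (Fin 2) ℂ) (i : Fin 2) :
    generators (m + 1) P (Sum.inr i) = discSym • generators m P (Sum.inr i) := by
  fin_cases i <;> simp only [generators, Sum.elim_inr, discSym_smul] <;> simp <;> ring

/-- The value of a combination of the generators of level `m + 1`, in terms of the generators of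
level `m`. -/
theorem linearCombination_generators_succ (m : ℕ) (P : ℕ → MvPolynomial (Fin 2) ℂ)
    (c : Fin (m + 1) ⊕ Fin 2 → SymPoly) :
    Fintype.linearCombination SymPoly (generators (m + 1) P) c
      = c (Sum.inl (Fin.last m)) • P (m + 1)
        + discSym • Fintype.linearCombination SymPoly (generators m P)
          (c ∘ Sum.map Fin.castSucc id) := by
  simp only [Fintype.linearCombination_apply, Fintype.sum_sum_type, Fin.sum_univ_castSucc,
    generators_succ_castSucc, generators_succ_last, generators_succ_inr, smul_add,
    Finset.smul_sum, Function.comp_apply, Sum.map_inl, Sum.map_inr, id]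
  simp only [smul_comm discSym]
  abel

theorem diag_smul (s : SymPoly) (F : MvPolynomial (Fin 2) ℂ) :
    diag (s • F) = diag (s : MvPolynomial (Fin 2) ℂ) * diag F := by
  rw [Subalgebra.smul_def, smul_eq_mul, map_mul]

theorem diag_discSym_smul (F : MvPolynomial (Fin 2) ℂ) : diag (discSym • F) = 0 := by
  rw [discSym_smul, map_mul, map_pow, map_sub, diag_X, diag_X]
  simp

/-- The polynomials `1` and `x - y` generate all polynomials over the symmetric ones. -/
theorem span_generators_zero (P : ℕ → MvPolynomial (Fin 2) ℂ) :
    Submodule.span SymPoly (Set.range (generators 0 P)) = ⊤ := by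
  refine eq_top_iff.mpr fun F _ => ?_
  set σ := rename (R := ℂ) (Equiv.swap (0 : Fin 2) 1) with hσ
  have hσσ : ∀ G, σ (σ G) = G := by
    intro G
    rw [hσ, rename_rename]
    have : (Equiv.swap (0 : Fin 2) 1) ∘ (Equiv.swap (0 : Fin 2) 1) = id := by
      funext i; simp
    rw [this, rename_id_apply]
  have hd : diag (F - σ F) = 0 := by
    rw [map_sub, hσ, diag_rename_swap, sub_self]
  obtain ⟨G, hG⟩ := X_sub_X_dvd_of_diag_eq_zero hd
  have hGs : G ∈ SymPoly := by
    rw [mem_SymPoly_iff, ← hσ]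
    have h1 := congrArg σ hG
    rw [map_sub, hσσ, map_mul, map_sub, hσ, rename_X, rename_X, Equiv.swap_apply_left,
      Equiv.swap_apply_right, ← hσ] at h1
    refine mul_left_cancel₀ X_sub_X_ne_zero ?_
    linear_combination h1 + hG
  have hFs : F + σ F ∈ SymPoly := by
    rw [mem_SymPoly_iff, ← hσ, map_add, hσσ, add_comm]
  have h2 : (C (1 / 2) : MvPolynomial (Fin 2) ℂ) * 2 = 1 := by
    rw [show (2 : MvPolynomial (Fin 2) ℂ) = C 2 from (map_ofNat C 2).symm, ← C_mul]
    simp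
  have hC : (C (1 / 2) : MvPolynomial (Fin 2) ℂ) ∈ SymPoly := SymPoly.algebraMap_mem _
  have e : F = (⟨C (1 / 2), hC⟩ * ⟨F + σ F, hFs⟩ : SymPoly) • generators 0 P (Sum.inr 0)
      + (⟨C (1 / 2), hC⟩ * ⟨G, hGs⟩ : SymPoly) • generators 0 P (Sum.inr 1) := by
    simp only [generators, Subalgebra.smul_def, smul_eq_mul, Sum.elim_inr, Subalgebra.coe_mul]
    simp only [mul_zero, pow_zero, zero_add, pow_one, Matrix.cons_val_zero, Matrix.cons_val_one]
    linear_combination (-F) * h2 + C (1 / 2) * hG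
  rw [e]
  exact add_mem (Submodule.smul_mem _ _ (Submodule.subset_span ⟨_, rfl⟩))
    (Submodule.smul_mem _ _ (Submodule.subset_span ⟨_, rfl⟩))

theorem relationModule_generators_zero (P : ℕ → MvPolynomial (Fin 2) ℂ) :
    relationModule (generators 0 P) = ⊥ := by
  rw [relationModule, LinearMap.ker_eq_bot']
  intro c hc
  set s := c (Sum.inr 0) with hs
  set t := c (Sum.inr 1) with ht
  have h1 : (s : MvPolynomial (Fin 2) ℂ) + (t : MvPolynomial (Fin 2) ℂ) * (X 0 - X 1) = 0 := by
    simpa [Fintype.linearCombination_apply, Fintype.sum_sum_type, generators,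
      Subalgebra.smul_def] using hc
  have h2 := congrArg (rename (Equiv.swap (0 : Fin 2) 1)) h1
  rw [map_add, map_mul, map_sub, rename_X, rename_X, Equiv.swap_apply_left,
    Equiv.swap_apply_right, mem_SymPoly_iff.mp s.2, mem_SymPoly_iff.mp t.2, map_zero] at h2
  have hs0 : (s : MvPolynomial (Fin 2) ℂ) = 0 := by
    have h3 : (2 : MvPolynomial (Fin 2) ℂ) * s = 0 := by linear_combination h1 + h2
    exact (mul_eq_zero.mp h3).resolve_left two_ne_zero
  have ht0 : (t : MvPolynomial (Fin 2) ℂ) = 0 := by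
    rw [hs0, zero_add] at h1
    exact (mul_eq_zero.mp h1).resolve_right X_sub_X_ne_zero
  funext i
  rcases i with i | i
  · exact i.elim0
  · fin_cases i
    · exact Subtype.ext hs0
    · exact Subtype.ext ht0

/-! From here on `Q` stands for the filtration `m ↦ Q_m(f)` and `P` for a choice of minimal
quasi-invariants; only the formal properties listed as hypotheses are needed. -/

variable {Q : ℕ → Submodule SymPoly (MvPolynomial (Fin 2) ℂ)} {P : ℕ → MvPolynomial (Fin 2) ℂ}

/-- An element of `Q_{m+1}` is reduced to `(x - y) ^ 2 Q_m` by subtracting the multiple of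
`P_{m+1}` with the same restriction to the diagonal. -/
theorem span_generators (hQ0 : Q 0 = ⊤) (hP : ∀ m, P (m + 1) ∈ Q (m + 1))
    (hmul : ∀ m, ∀ F ∈ Q m, discSym • F ∈ Q (m + 1))
    (hker : ∀ m, ∀ F ∈ Q (m + 1), diag F = 0 → ∃ G ∈ Q m, F = discSym • G)
    (hdvd : ∀ m, ∀ F ∈ Q (m + 1), diag (P (m + 1)) ∣ diag F) (m : ℕ) :
    Submodule.span SymPoly (Set.range (generators m P)) = Q m := by
  induction m with
  | zero => rw [span_generators_zero, hQ0]
  | succ m ih =>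
    rw [← Fintype.range_linearCombination] at ih ⊢
    refine le_antisymm ?_ fun F hF => ?_
    · rintro _ ⟨c, rfl⟩
      rw [linearCombination_generators_succ]
      exact add_mem ((Q (m + 1)).smul_mem _ (hP m)) (hmul m _ (ih ▸ ⟨_, rfl⟩))
    · obtain ⟨h, hh⟩ := hdvd m F hF
      obtain ⟨G, hG, hFG⟩ := hker m (F - (⟨symLift h, symLift_mem h⟩ : SymPoly) • P (m + 1))
        (sub_mem hF ((Q (m + 1)).smul_mem _ (hP m)))
        (by rw [map_sub, diag_smul, hh, diag_symLift]; ring)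
      rw [← ih] at hG
      obtain ⟨c, rfl⟩ := hG
      refine ⟨Sum.elim (Fin.snoc (c ∘ Sum.inl) (⟨symLift h, symLift_mem h⟩ : SymPoly))
        (c ∘ Sum.inr), ?_⟩
      rw [linearCombination_generators_succ]
      have : Sum.elim (Fin.snoc (α := fun _ => SymPoly) (c ∘ Sum.inl) ⟨symLift h, symLift_mem h⟩)
          (c ∘ Sum.inr) ∘ Sum.map Fin.castSucc id = c := by
        funext i
        rcases i with i | i <;> simp
      rw [this, ← hFG, Sum.elim_inl, Fin.snoc_last]
      abel

/-- The relations are triangular: the last one expresses `(x - y) ^ 2 P_{m+1}` through the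
generators of `(x - y) ^ 2 Q_m`, and the coefficient of `P_{m+1}` in any relation is divisible by
`(x - y) ^ 2`. -/
theorem exists_basis_relationModule (hQ0 : Q 0 = ⊤) (hP : ∀ m, P (m + 1) ∈ Q (m + 1))
    (hle : ∀ m, Q (m + 1) ≤ Q m) (hmul : ∀ m, ∀ F ∈ Q m, discSym • F ∈ Q (m + 1))
    (hker : ∀ m, ∀ F ∈ Q (m + 1), diag F = 0 → ∃ G ∈ Q m, F = discSym • G)
    (hdvd : ∀ m, ∀ F ∈ Q (m + 1), diag (P (m + 1)) ∣ diag F)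
    (hne : ∀ m, diag (P (m + 1)) ≠ 0) (m : ℕ) :
    ∃ r : Fin m → (Fin m ⊕ Fin 2 → SymPoly), LinearIndependent SymPoly r ∧
      Submodule.span SymPoly (Set.range r) = relationModule (generators m P) := by
  induction m with
  | zero =>
    refine ⟨Fin.elim0, linearIndependent_empty_type, ?_⟩
    rw [relationModule_generators_zero, Set.range_eq_empty, Submodule.span_empty]
  | succ m ih =>
    obtain ⟨r, hr, hrs⟩ := ih
    obtain ⟨c, hc⟩ : ∃ c, Fintype.linearCombination SymPoly (generators m P) c = P (m + 1) := by
      have h1 := hle m (hP m)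
      rw [← span_generators hQ0 hP hmul hker hdvd m, ← Fintype.range_linearCombination] at h1
      exact h1
    -- extension of a family of coefficients by the coefficient `s` of `P (m + 1)`
    let ext (v : Fin m ⊕ Fin 2 → SymPoly) (s : SymPoly) : Fin (m + 1) ⊕ Fin 2 → SymPoly :=
      Sum.elim (Fin.snoc (v ∘ Sum.inl) s) (v ∘ Sum.inr)
    have ext_last : ∀ v s, ext v s (Sum.inl (Fin.last m)) = s := fun v s => by simp [ext]
    have ext_comp : ∀ v s, ext v s ∘ Sum.map Fin.castSucc id = v := fun v s => by
      funext i
      rcases i with i | i <;> simp [ext]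
    have eq_iff : ∀ v w : Fin (m + 1) ⊕ Fin 2 → SymPoly,
        v (Sum.inl (Fin.last m)) = w (Sum.inl (Fin.last m)) →
        v ∘ Sum.map Fin.castSucc id = w ∘ Sum.map Fin.castSucc id → v = w := by
      intro v w h1 h2
      funext i
      rcases i with i | i
      · refine Fin.lastCases h1 (fun j => ?_) i
        exact congrFun h2 (Sum.inl j)
      · exact congrFun h2 (Sum.inr i)
    let R : Fin (m + 1) → (Fin (m + 1) ⊕ Fin 2 → SymPoly) :=
      Fin.snoc (fun i => ext (r i) 0) (ext (-c) discSym)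
    have R_cast : ∀ i : Fin m, R i.castSucc = ext (r i) 0 := fun i => by simp [R]
    have R_last : R (Fin.last m) = ext (-c) discSym := by simp [R]
    have sum_last : ∀ d : Fin (m + 1) → SymPoly,
        (∑ i, d i • R i) (Sum.inl (Fin.last m)) = d (Fin.last m) * discSym := by
      intro d
      rw [Fin.sum_univ_castSucc]
      simp [R_cast, R_last, ext_last, Finset.sum_apply]
    have sum_comp : ∀ d : Fin (m + 1) → SymPoly,
        (∑ i, d i • R i) ∘ Sum.map Fin.castSucc id
          = ∑ i : Fin m, d i.castSucc • r i - d (Fin.last m) • c := by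
      intro d
      have hcomp : ∀ v, LinearMap.funLeft SymPoly SymPoly (Sum.map (Fin.castSucc (n := m))
        (id : Fin 2 → Fin 2)) v = v ∘ Sum.map Fin.castSucc id := fun _ => rfl
      rw [← hcomp, map_sum, Fin.sum_univ_castSucc]
      simp only [map_smul, R_cast, R_last]
      simp only [hcomp, ext_comp, smul_neg, sub_eq_add_neg]
    refine ⟨R, ?_, le_antisymm ?_ fun v hv => ?_⟩
    · rw [Fintype.linearIndependent_iff]
      intro d hd
      have h1 := sum_last d
      rw [hd, Pi.zero_apply] at h1
      have h2 : d (Fin.last m) = 0 := (mul_eq_zero.mp h1.symm).resolve_right discSym_ne_zero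
      have h3 := sum_comp d
      rw [hd, h2, zero_smul, sub_zero] at h3
      have h4 := Fintype.linearIndependent_iff.mp hr (fun i => d i.castSucc) (h3.symm.trans rfl)
      exact fun i => Fin.lastCases h2 h4 i
    · rw [Submodule.span_le]
      rintro _ ⟨i, rfl⟩
      rw [SetLike.mem_coe, relationModule, LinearMap.mem_ker, linearCombination_generators_succ]
      refine Fin.lastCases ?_ (fun j => ?_) i
      · rw [R_last, ext_last, ext_comp, map_neg, hc, smul_neg, add_neg_cancel]
      · have h1 : r j ∈ relationModule (generators m P) := hrs ▸ Submodule.subset_span ⟨j, rfl⟩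
        rw [R_cast, ext_last, ext_comp, LinearMap.mem_ker.mp h1, zero_smul, smul_zero, add_zero]
    · rw [relationModule, LinearMap.mem_ker, linearCombination_generators_succ] at hv
      have h1 := congrArg diag hv
      rw [map_add, diag_smul, diag_discSym_smul, add_zero, map_zero] at h1
      obtain ⟨t, ht⟩ := exists_eq_discSym_mul ((mul_eq_zero.mp h1).resolve_right (hne m))
      have h2 : v ∘ Sum.map Fin.castSucc id + t • c ∈ relationModule (generators m P) := by
        rw [relationModule, LinearMap.mem_ker, map_add, map_smul, hc]
        rw [ht, mul_comm, mul_smul, ← smul_add] at hv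
        have h3 := (mul_eq_zero.mp (show (discSym : MvPolynomial (Fin 2) ℂ) * _ = 0 from hv))
        rw [add_comm]
        exact h3.resolve_left (pow_ne_zero 2 X_sub_X_ne_zero)
      rw [← hrs, ← Fintype.range_linearCombination] at h2
      rw [← Fintype.range_linearCombination]
      obtain ⟨d, hd⟩ := h2
      rw [Fintype.linearCombination_apply] at hd
      refine ⟨Fin.snoc d t, ?_⟩
      rw [Fintype.linearCombination_apply]
      refine eq_iff _ _ ?_ ?_
      · rw [sum_last, Fin.snoc_last, ht]
      · rw [sum_comp]
        simp only [Fin.snoc_castSucc, Fin.snoc_last, hd, add_sub_cancel_right]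

end Relations

/-! ### Hilbert series -/

section Hilbert

open MvPolynomial

theorem homogeneousComponent_mul_of_isHomogeneous {A : MvPolynomial (Fin 2) ℂ} {e : ℕ}
    (hA : A.IsHomogeneous e) (k : ℕ) (G : MvPolynomial (Fin 2) ℂ) :
    homogeneousComponent (e + k) (A * G) = A * homogeneousComponent k G := by
  conv_lhs => rw [← sum_homogeneousComponent G, Finset.mul_sum, map_sum]
  have h : ∀ i, homogeneousComponent (e + k) (A * homogeneousComponent i G)
      = if k = i then A * homogeneousComponent i G else 0 := by
    intro i
    rw [homogeneousComponent_of_mem (hA.mul (homogeneousComponent_isHomogeneous i G))]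
    simp
  simp only [h, Finset.sum_ite_eq, Finset.mem_range]
  split_ifs with hk
  · rfl
  · rw [homogeneousComponent_eq_zero k G (by omega), mul_zero]

theorem diag_homogeneousComponent (d : ℕ) (F : MvPolynomial (Fin 2) ℂ) :
    diag (homogeneousComponent d F)
      = Polynomial.C ((diag F).coeff d) * Polynomial.X ^ d := by
  induction F using MvPolynomial.monomial_add_induction_on with
  | C c =>
    rw [homogeneousComponent_of_mem (isHomogeneous_C (Fin 2) c), diag, aeval_C,
      Polynomial.algebraMap_eq, Polynomial.coeff_C]
    rcases eq_or_ne d 0 with rfl | hd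
    · simp
    · simp [hd]
  | monomial_add s c F _ _ hF =>
    have hm : diag (monomial s c) = Polynomial.C c * Polynomial.X ^ s.degree := by
      rw [diag, aeval_monomial, Polynomial.algebraMap_eq, Finsupp.prod_fintype _ _ (by simp),
        Finsupp.degree_eq_sum]
      simp [pow_add]
    rw [map_add, map_add, hF, map_add, Polynomial.coeff_add, Polynomial.C_add, add_mul,
      homogeneousComponent_of_mem (isHomogeneous_monomial c rfl), hm]
    congr 1
    split_ifs with h
    · rw [hm, h]; simp
    · rw [Polynomial.coeff_C_mul, Polynomial.coeff_X_pow, if_neg h]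
      simp

variable {V W : Submodule ℂ (MvPolynomial (Fin 2) ℂ)} {P : MvPolynomial (Fin 2) ℂ} {r n : ℕ}

/-- The leading forms of `V`, when restriction to the diagonal maps `V` onto the ideal generated by
`diag P` with kernel `(x - y) ^ r W`. The hypotheses on degrees make the exact sequence strict for
the filtrations by degree. -/
theorem leadingForms_eq_sup (hPd : P.totalDegree ≤ n) (hPn : (diag P).natDegree = n)
    (hPV : ∀ h, symLift h * P ∈ V) (hW : ∀ G ∈ W, (X 0 - X 1) ^ r * G ∈ V)
    (hdvd : ∀ F ∈ V, diag P ∣ diag F)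
    (hker : ∀ F ∈ V, diag F = 0 → ∃ G ∈ W, F = (X 0 - X 1) ^ r * G) (d : ℕ) :
    leadingForms V d
      = (if r ≤ d then (leadingForms W (d - r)).map
          (LinearMap.mulLeft ℂ ((X 0 - X 1 : MvPolynomial (Fin 2) ℂ) ^ r)) else ⊥)
        ⊔ (if n ≤ d then Submodule.span ℂ {symLift Polynomial.X ^ (d - n)
          * homogeneousComponent n P} else ⊥) := by
  have hker' : ∀ F ∈ V, diag F = 0 → F.totalDegree ≤ d → homogeneousComponent d F ∈
      (if r ≤ d then (leadingForms W (d - r)).map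
        (LinearMap.mulLeft ℂ ((X 0 - X 1 : MvPolynomial (Fin 2) ℂ) ^ r)) else ⊥) := by
    intro F hF hF0 hFd
    obtain ⟨G, hG, rfl⟩ := hker F hF hF0
    rcases eq_or_ne G 0 with rfl | hG0
    · simp
    rw [totalDegree_mul_of_isDomain (pow_ne_zero r X_sub_X_ne_zero) hG0,
      (isHomogeneous_X_sub_X_pow r).totalDegree (pow_ne_zero r X_sub_X_ne_zero)] at hFd
    have hrd : r ≤ d := by omega
    rw [if_pos hrd]
    refine ⟨homogeneousComponent (d - r) G, ⟨G, ⟨hG, ?_⟩, rfl⟩, ?_⟩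
    · rw [SetLike.mem_coe, mem_restrictTotalDegree]; omega
    · have := homogeneousComponent_mul_of_isHomogeneous (isHomogeneous_X_sub_X_pow r) (d - r) G
      rw [Nat.add_sub_cancel' hrd] at this
      exact this.symm
  have htop : ∀ h : Polynomial ℂ, n ≤ d → h.natDegree ≤ d - n →
      homogeneousComponent d (symLift h * P)
        = h.coeff (d - n) • (symLift Polynomial.X ^ (d - n) * homogeneousComponent n P) := by
    intro h hnd hh
    have key : ∀ i ≤ d - n, homogeneousComponent d (symLift Polynomial.X ^ i * P)
        = if i = d - n then symLift Polynomial.X ^ (d - n) * homogeneousComponent n P else 0 := by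
      intro i hi
      have := homogeneousComponent_mul_of_isHomogeneous (isHomogeneous_symLift_X_pow i) (d - i) P
      rw [show i + (d - i) = d by omega] at this
      rw [this]
      split_ifs with hid
      · rw [hid, show d - (d - n) = n by omega]
      · rw [homogeneousComponent_eq_zero (d - i) P (by omega), mul_zero]
    rw [symLift_eq_sum hh, Finset.sum_mul, map_sum, Finset.sum_eq_single (d - n)]
    · rw [mul_assoc, homogeneousComponent_C_mul, key _ le_rfl, if_pos rfl, C_mul']
    · intro i hi hne
      have hi' : i ≤ d - n := Nat.lt_succ_iff.mp (Finset.mem_range.mp hi)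
      rw [mul_assoc, homogeneousComponent_C_mul, key _ hi', if_neg hne, mul_zero]
    · intro hni
      exact absurd (Finset.mem_range.mpr (Nat.lt_succ_self _)) hni
  have hdegP : ∀ h : Polynomial ℂ, n ≤ d → h.natDegree ≤ d - n →
      (symLift h * P).totalDegree ≤ d := by
    intro h hnd hh
    have h1 := totalDegree_mul (symLift h) P
    have h2 := totalDegree_symLift_le h
    omega
  refine le_antisymm ?_ (sup_le ?_ ?_)
  · rintro _ ⟨F, ⟨hFV, hFd⟩, rfl⟩
    rw [SetLike.mem_coe, mem_restrictTotalDegree] at hFd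
    by_cases hF0 : diag F = 0
    · exact Submodule.mem_sup_left (hker' F hFV hF0 hFd)
    obtain ⟨h, hh⟩ := hdvd F hFV
    have hdeg := natDegree_diag_le F
    rw [hh] at hF0
    rw [hh, Polynomial.natDegree_mul (left_ne_zero_of_mul hF0) (right_ne_zero_of_mul hF0),
      hPn] at hdeg
    have hnd : n ≤ d := by omega
    have hhd : h.natDegree ≤ d - n := by omega
    have h1 := hker' (F - symLift h * P) (sub_mem hFV (hPV h))
      (by rw [map_sub, map_mul, diag_symLift, hh]; ring)
      ((totalDegree_sub _ _).trans (max_le hFd (hdegP h hnd hhd)))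
    rw [map_sub, htop h hnd hhd] at h1
    rw [← sub_add_cancel (homogeneousComponent d F)
      (h.coeff (d - n) • (symLift Polynomial.X ^ (d - n) * homogeneousComponent n P))]
    refine Submodule.add_mem_sup h1 ?_
    rw [if_pos hnd]
    exact Submodule.smul_mem _ _ (Submodule.mem_span_singleton_self _)
  · split_ifs with hrd
    · rintro _ ⟨_, ⟨G, ⟨hGW, hGd⟩, rfl⟩, rfl⟩
      rw [SetLike.mem_coe, mem_restrictTotalDegree] at hGd
      have := homogeneousComponent_mul_of_isHomogeneous (isHomogeneous_X_sub_X_pow r) (d - r) G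
      rw [Nat.add_sub_cancel' hrd] at this
      rw [LinearMap.mulLeft_apply, ← this]
      refine ⟨_, ⟨hW G hGW, ?_⟩, rfl⟩
      rw [SetLike.mem_coe, mem_restrictTotalDegree]
      have h1 := totalDegree_mul ((X 0 - X 1 : MvPolynomial (Fin 2) ℂ) ^ r) G
      have h2 := (isHomogeneous_X_sub_X_pow r).totalDegree_le
      omega
    · exact bot_le
  · split_ifs with hnd
    · rw [Submodule.span_singleton_le_iff_mem]
      have h1 : (Polynomial.X ^ (d - n) : Polynomial ℂ).natDegree ≤ d - n := by simp
      have := htop _ hnd h1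
      rw [Polynomial.coeff_X_pow_self, one_smul] at this
      rw [← this]
      refine ⟨_, ⟨hPV _, ?_⟩, rfl⟩
      rw [SetLike.mem_coe, mem_restrictTotalDegree]
      exact hdegP _ hnd h1
    · exact bot_le

instance finite_leadingForms (V : Submodule ℂ (MvPolynomial (Fin 2) ℂ)) (d : ℕ) :
    Module.Finite ℂ (leadingForms V d) := by
  unfold leadingForms
  infer_instance

/-- The recursion for Hilbert series along the exact sequence `0 → (x - y) ^ r W → V → (diag P) → 0`
given by restriction to the diagonal. -/
theorem hilbertSeries_eq (hr : r ≠ 0) (hPd : P.totalDegree ≤ n) (hPn : (diag P).natDegree = n)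
    (hP0 : diag P ≠ 0) (hPV : ∀ h, symLift h * P ∈ V) (hW : ∀ G ∈ W, (X 0 - X 1) ^ r * G ∈ V)
    (hdvd : ∀ F ∈ V, diag P ∣ diag F)
    (hker : ∀ F ∈ V, diag F = 0 → ∃ G ∈ W, F = (X 0 - X 1) ^ r * G) :
    hilbertSeries V = PowerSeries.X ^ r * hilbertSeries W
      + PowerSeries.X ^ n * PowerSeries.mk fun _ => 1 := by
  ext d
  rw [map_add, PowerSeries.coeff_X_pow_mul', PowerSeries.coeff_X_pow_mul', hilbertSeries,
    hilbertSeries, PowerSeries.coeff_mk, PowerSeries.coeff_mk, PowerSeries.coeff_mk]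
  have hL := leadingForms_eq_sup hPd hPn hPV hW hdvd hker d
  set A : Submodule ℂ (MvPolynomial (Fin 2) ℂ) := if r ≤ d then (leadingForms W (d - r)).map
    (LinearMap.mulLeft ℂ ((X 0 - X 1 : MvPolynomial (Fin 2) ℂ) ^ r)) else ⊥ with hA
  set B : Submodule ℂ (MvPolynomial (Fin 2) ℂ) := if n ≤ d then
    Submodule.span ℂ {symLift Polynomial.X ^ (d - n) * homogeneousComponent n P} else ⊥ with hB
  have hdv : diag (symLift Polynomial.X ^ (d - n) * homogeneousComponent n P) ≠ 0 := by
    rw [map_mul, map_pow, diag_symLift, diag_homogeneousComponent, ← hPn]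
    refine mul_ne_zero (pow_ne_zero _ Polynomial.X_ne_zero) (mul_ne_zero ?_
      (pow_ne_zero _ Polynomial.X_ne_zero))
    simpa using hP0
  clear_value A B
  have fA : Module.finrank ℂ A
      = if r ≤ d then Module.finrank ℂ (leadingForms W (d - r)) else 0 := by
    by_cases hrd : r ≤ d
    · rw [if_pos hrd] at hA ⊢
      rw [hA]
      refine (Submodule.equivMapOfInjective (LinearMap.mulLeft ℂ
        ((X 0 - X 1 : MvPolynomial (Fin 2) ℂ) ^ r)) ?_ (leadingForms W (d - r))).symm.finrank_eq
      exact fun _ _ h => mul_left_cancel₀ (pow_ne_zero r X_sub_X_ne_zero) h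
    · rw [if_neg hrd] at hA ⊢
      rw [hA, finrank_bot]
  have fB : Module.finrank ℂ B = if n ≤ d then 1 else 0 := by
    by_cases hnd : n ≤ d
    · rw [if_pos hnd] at hB ⊢
      rw [hB]
      exact finrank_span_singleton fun h => hdv (by rw [h, map_zero])
    · rw [if_neg hnd] at hB ⊢
      rw [hB, finrank_bot]
  -- the first summand vanishes on the diagonal and the second one does not
  have hAB : A ⊓ B = ⊥ := by
    rw [Submodule.eq_bot_iff]
    rintro v ⟨hvA, hvB⟩
    have h0 : diag v = 0 := by
      rw [SetLike.mem_coe, hA] at hvA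
      split_ifs at hvA
      · obtain ⟨G, -, rfl⟩ := hvA
        rw [LinearMap.mulLeft_apply, map_mul, map_pow, map_sub, diag_X, diag_X, sub_self,
          zero_pow hr, zero_mul]
      · rw [(Submodule.mem_bot ℂ).mp hvA, map_zero]
    rw [SetLike.mem_coe, hB] at hvB
    split_ifs at hvB
    · obtain ⟨c, rfl⟩ := Submodule.mem_span_singleton.mp hvB
      rw [map_smul] at h0
      rw [(smul_eq_zero.mp h0).resolve_right hdv, zero_smul]
    · exact (Submodule.mem_bot ℂ).mp hvB
  have hle : A ≤ leadingForms V d ∧ B ≤ leadingForms V d :=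
    ⟨hL ▸ le_sup_left, hL ▸ le_sup_right⟩
  have : Module.Finite ℂ A := Submodule.finiteDimensional_of_le hle.1
  have : Module.Finite ℂ B := Submodule.finiteDimensional_of_le hle.2
  have h1 := Submodule.finrank_sup_add_finrank_inf_eq A B
  rw [hAB, finrank_bot, add_zero, ← hL, fA, fB] at h1
  rw [h1]
  push_cast
  rfl

theorem mk_one_mul_one_sub_X :
    (PowerSeries.mk fun _ => 1 : PowerSeries ℤ) * (1 - PowerSeries.X) = 1 :=
  PowerSeries.mk_one_mul_one_sub_eq_one ℤ

theorem hilbertSeries_top_mul : hilbertSeries ⊤ * ((1 - PowerSeries.X) * (1 - PowerSeries.X ^ 2))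
    = 1 + PowerSeries.X := by
  have h := hilbertSeries_eq (V := ⊤) (W := ⊤) (P := 1) (r := 1) (n := 0) one_ne_zero (by simp)
    (by simp) (by simp) (fun _ => trivial) (fun _ _ => trivial) (fun _ _ => by simp)
    (fun F _ hF => by
      obtain ⟨G, hG⟩ := X_sub_X_dvd_of_diag_eq_zero hF
      exact ⟨G, trivial, by rw [pow_one, hG]⟩)
  have h1 := mk_one_mul_one_sub_X
  linear_combination (1 - PowerSeries.X ^ 2) * h + (1 + PowerSeries.X) * h1
end Hilbert

theorem theorem3p12 (m k : ℕ) (a b : Fin k → ℂ) (ha : Function.Injective a)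
    (f : ℂ → ℂ) (hf : IsPowerProduct a b f) :
    hilbertSeries ((quasiInvariants m f).restrictScalars ℂ)
        * ((1 - PowerSeries.X) * (1 - PowerSeries.X ^ 2))
      = PowerSeries.X ^ (2 * m) + PowerSeries.X ^ (2 * m + 1)
        + ∑ i ∈ Finset.Icc 1 m, PowerSeries.X ^ (2 * (m - i) + dTotal i b)
        - ∑ i ∈ Finset.Icc 1 m, PowerSeries.X ^ (2 * (m - i) + dTotal i b + 2) ∧
    ∃ P : ℕ → MvPolynomial (Fin 2) ℂ,
      (∀ i ∈ Finset.Icc 1 m,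
        P i ∈ quasiInvariants i f ∧
        MvPolynomial.aeval ![Polynomial.X, Polynomial.X] (P i)
          = ∏ j, (Polynomial.X - Polynomial.C (a j)) ^ dExp i (b j) ∧
        (P i).totalDegree = dTotal i b) ∧
      Submodule.span SymPoly (Set.range (generators m P)) = quasiInvariants m f ∧
      ∃ r : Fin m → (Fin m ⊕ Fin 2 → SymPoly),
        LinearIndependent SymPoly r ∧
        Submodule.span SymPoly (Set.range r) = relationModule (generators m P) := by
  choose P hP hPd hPdiag using hf.exists_mem_quasiInvariants
  have hnat : ∀ i, (diag (P i)).natDegree = dTotal i b := by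
    intro i
    rw [hPdiag, Polynomial.natDegree_prod_of_monic _ _ fun j _ =>
      (Polynomial.monic_X_sub_C _).pow _]
    simp [dTotal]
  have hne : ∀ i, diag (P i) ≠ 0 := fun i => by
    rw [hPdiag]
    exact (Polynomial.monic_prod_of_monic _ _ fun j _ =>
      (Polynomial.monic_X_sub_C _).pow _).ne_zero
  have hQ0 := quasiInvariants_zero hf
  have hdvd : ∀ i, ∀ F ∈ quasiInvariants i f, diag (P i) ∣ diag F := fun i F hF => by
    rw [hPdiag]
    exact hf.prod_dvd_diag ha hF
  have hmul : ∀ i, ∀ F ∈ quasiInvariants i f, discSym • F ∈ quasiInvariants (i + 1) f :=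
    fun i F hF => X_sub_X_sq_mul_mem.mpr hF
  have hker : ∀ i, ∀ F ∈ quasiInvariants (i + 1) f, diag F = 0 →
      ∃ G ∈ quasiInvariants i f, F = discSym • G :=
    fun i F hF h0 => exists_eq_of_diag_eq_zero hf hF h0
  refine ⟨?_, P, fun i _ => ⟨hP i, hPdiag i, le_antisymm (hPd i) ?_⟩,
    span_generators hQ0 (fun i => hP (i + 1)) hmul hker (fun i => hdvd (i + 1)) m,
    exists_basis_relationModule hQ0 (fun i => hP (i + 1)) (fun i => quasiInvariants_succ_le i f)
      hmul hker (fun i => hdvd (i + 1)) (fun i => hne (i + 1)) m⟩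
  · induction m with
    | zero =>
      have : (quasiInvariants 0 f).restrictScalars ℂ = ⊤ := by rw [hQ0]; rfl
      rw [this, hilbertSeries_top_mul]
      simp
    | succ m ih =>
      have h := hilbertSeries_eq (V := (quasiInvariants (m + 1) f).restrictScalars ℂ)
        (W := (quasiInvariants m f).restrictScalars ℂ) (P := P (m + 1)) (r := 2) two_ne_zero
        (hPd (m + 1)) (hnat (m + 1)) (hne (m + 1))
        (fun h => (quasiInvariants (m + 1) f).smul_mem ⟨symLift h, symLift_mem h⟩ (hP (m + 1)))
        (hmul m) (hdvd (m + 1)) (hker m)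
      have h1 := mk_one_mul_one_sub_X
      have e1 : ∀ s : ℕ, ∑ i ∈ Finset.Icc 1 m,
          (PowerSeries.X : PowerSeries ℤ) ^ (2 * (m + 1 - i) + dTotal i b + s)
          = PowerSeries.X ^ 2
            * ∑ i ∈ Finset.Icc 1 m, PowerSeries.X ^ (2 * (m - i) + dTotal i b + s) := by
        intro s
        rw [Finset.mul_sum]
        refine Finset.sum_congr rfl fun i hi => ?_
        rw [← pow_add]
        congr 1
        have := (Finset.mem_Icc.mp hi).2
        omega
      have e2 := e1 0
      simp only [add_zero] at e2
      rw [Finset.sum_Icc_succ_top (by omega), Finset.sum_Icc_succ_top (by omega), e1 2, e2,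
        Nat.sub_self, mul_zero, zero_add]
      linear_combination (1 - PowerSeries.X) * (1 - PowerSeries.X ^ 2) * h + PowerSeries.X ^ 2 * ih
        + PowerSeries.X ^ dTotal (m + 1) b * (1 - PowerSeries.X ^ 2) * h1
  · rw [← hnat i]
    exact natDegree_diag_le (P i)
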